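/- Let $\alpha\in(1,\infty)$ and $\beta\in[1,\infty)$. Let $X,Y,Z$ be real random variables with Borel alphabets $\mathcal X,\mathcal Y,\mathcal Z\subseteq\mathbb R$, where $\mathcal X$ and $\mathcal Z$ are contained in the closure of their interior (for instance $\mathbb R$, or intervals of positive length), having a joint pdf $f_{XYZ}$ that is continuous on $\mathcal X\times\mathcal Y\times\mathcal Z$. Let $f_{XZ}$, $f_Z$, $f_{X|Z=z}$, $f_{Y|X,Z}=f_{XYZ}/f_{XZ}$ be the marginal and conditional densities obtained from it by integration, and assume that the conditional density $(x,y,z)\mapsto f_{Y|X,Z}(y|x,z)$ is continuous on the set of $(x,y,z)\in\mathcal X\times\mathcal Y\times\mathcal Z$ with $0<f_{XZ}(x,z)<\infty$. Put $S_Z=\{z\in\mathcal Z: 0<f_Z(z)<\infty\}$ and, for $z\in S_Z$, $S_z=\{x\in\mathcal X: 0<f_{X|Z=z}(x)<\infty\}$. The conditional maximal $(\alpha,\beta)$-leakage from $X$ to $Y$ given $Z$ is $$\mathcal L_{\alpha,\beta}(X\to Y|Z)=\sup_{q_{X|Z}}\ \sup_{U-X-Y|Z}\ \frac{\alpha}{(\alpha-1)\beta}\log\frac{\sup_{P_{\hat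 U|Z,Y}}\mathbb E_{Z,Y}\Big[\big(\sum_u P_{U|Z,Y}(u|Z,Y)\,P_{\hat U|Z,Y}(u|Z,Y)^{\frac{\alpha-1}{\alpha}}\big)^{\beta}\Big]}{\sup_{P_{\hat U|Z}}\mathbb E_{Z}\Big[\big(\sum_u P_{U|Z}(u|Z)\,P_{\hat U|Z}(u|Z)^{\frac{\alpha-1}{\alpha}}\big)^{\beta}\Big]},$$ where $q_{X|Z}$ ranges over all measurable families of pdfs $q_{X|Z}(\cdot|z)$ supported on $S_z$, $U$ ranges over all random variables with an arbitrary finite alphabet and arbitrary conditional law $P_{U|X,Z}$, the estimator $\hat U$ has the same alphabet as $U$, and all laws are computed from $f_Z(z)\,q_{X|Z}(x|z)\,P_{U|X,Z}(u|x,z)\,f_{Y|X,Z}(y|x,z)$. Then, in $[-\infty,\infty]$, $$\mathcal L_{\alpha,\beta}(X\to Y|Z)=\sup_{z\in S_Z}\ \sup_{x'\in S_z}\ \sup_{f_{\tilde X|Z=z}}\ \frac{\alpha}{(\alpha-1)\beta}\log\int_{\mathcal Y}f_{Y|X,Z}(y|x',z)^{1-\beta}\Big(\int_{\mathcal X}f_{Y|X,Z}(y|x,z)^{\alpha}f_{\tilde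 X|Z=z}(x)\,dx\Big)^{\frac{\beta}{\alpha}}dy,$$ where $f_{\tilde X|Z=z}$ ranges over all pdfs supported on $S_z$, with the conventions $0^0=1$, $0^{1-\beta}=\infty$ for $\beta>1$, and $\infty\cdot 0=0$. -/

import Mathlib

open MeasureTheory Set
open scoped ENNReal

noncomputable section

namespace CondLeakage

/-- `X`, `Y`, `Z` are real random variables with alphabets `𝒳`, `𝒴`, `𝒵` and joint pdf `f`
(the value of `f` at `(x, y, z)` is the joint density `f_{XYZ}(x, y, z)`). -/
structure HasJointPDF {Ω : Type*} [MeasurableSpace Ω] (P : Measure Ω) (X Y Z : Ω → ℝ)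
    (𝒳 𝒴 𝒵 : Set ℝ) (f : ℝ × ℝ × ℝ → ℝ) : Prop where
  measurable_X : Measurable X
  measurable_Y : Measurable Y
  measurable_Z : Measurable Z
  nonneg : ∀ p ∈ 𝒳 ×ˢ 𝒴 ×ˢ 𝒵, 0 ≤ f p
  law : P.map (fun ω => (X ω, Y ω, Z ω)) =
    (volume.restrict (𝒳 ×ˢ 𝒴 ×ˢ 𝒵)).withDensity (fun p => ENNReal.ofReal (f p))

/-- The marginal density `f_{XZ}(x, z)`. -/
def pdfXZ (𝒴 : Set ℝ) (f : ℝ × ℝ × ℝ → ℝ) (x z : ℝ) : ℝ≥0∞ :=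
  ∫⁻ y in 𝒴, ENNReal.ofReal (f (x, y, z))

/-- The marginal density `f_Z(z)`. -/
def pdfZ (𝒳 𝒴 : Set ℝ) (f : ℝ × ℝ × ℝ → ℝ) (z : ℝ) : ℝ≥0∞ :=
  ∫⁻ x in 𝒳, pdfXZ 𝒴 f x z

/-- The conditional density `f_{X|Z}(x|z)`. -/
def pdfXgivenZ (𝒳 𝒴 : Set ℝ) (f : ℝ × ℝ × ℝ → ℝ) (x z : ℝ) : ℝ≥0∞ :=
  pdfXZ 𝒴 f x z / pdfZ 𝒳 𝒴 f z

/-- The conditional density `f_{Y|X,Z}(y|x,z)`; it is meaningful where `0 < f_{XZ}(x, z) < ∞`. -/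
def pdfYgivenXZ (𝒴 : Set ℝ) (f : ℝ × ℝ × ℝ → ℝ) (y x z : ℝ) : ℝ≥0∞ :=
  ENNReal.ofReal (f (x, y, z)) / pdfXZ 𝒴 f x z

/-- The support of `Z`. The (Lebesgue-null) set where the marginal integral diverges is left out,
since there is no conditional density there. -/
def suppZ (𝒳 𝒴 𝒵 : Set ℝ) (f : ℝ × ℝ × ℝ → ℝ) : Set ℝ :=
  {z | z ∈ 𝒵 ∧ 0 < pdfZ 𝒳 𝒴 f z ∧ pdfZ 𝒳 𝒴 f z < ∞}

/-- The support of `f_{X|Z=z}`. For `z` in the support of `Z`, the (Lebesgue-null) set where the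
marginal integral `f_{XZ}(x, z)` diverges is left out, since there is no conditional density of `Y`
there. -/
def suppX (𝒳 𝒴 : Set ℝ) (f : ℝ × ℝ × ℝ → ℝ) (z : ℝ) : Set ℝ :=
  {x | x ∈ 𝒳 ∧ 0 < pdfXgivenZ 𝒳 𝒴 f x z ∧ pdfXgivenZ 𝒳 𝒴 f x z < ∞}

/-- `g` is a probability density on `S` with respect to Lebesgue measure. -/
structure IsPDFOn (S : Set ℝ) (g : ℝ → ℝ≥0∞) : Prop where
  measurable : Measurable g
  zero_off : ∀ x, x ∉ S → g x = 0
  lintegral_eq_one : ∫⁻ x, g x = 1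

/-- `q x z` is a conditional density `f_{X|Z}(x|z)` that is admissible in the supremum over the
conditional laws of `X` given `Z`: a measurable family of densities, the one at `z` living on the
support of the true `f_{X|Z=z}`, where the channel `f_{Y|X,Z}` is given. -/
structure IsCondPDF (𝒳 𝒴 𝒵 : Set ℝ) (f : ℝ × ℝ × ℝ → ℝ) (q : ℝ → ℝ → ℝ≥0∞) : Prop where
  measurable : Measurable (fun p : ℝ × ℝ => q p.1 p.2)
  isPDFOn : ∀ z ∈ suppZ 𝒳 𝒴 𝒵 f, IsPDFOn (suppX 𝒳 𝒴 f z) (fun x => q x z)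

/-- `w u a` is a conditional probability mass function of a variable with alphabet `Fin n` given an
observation `a`. -/
structure IsCondPMF {A : Type} [MeasurableSpace A] {n : ℕ} (w : Fin n → A → ℝ≥0∞) : Prop where
  measurable : ∀ u, Measurable (w u)
  sum_eq_one : ∀ a, ∑ u, w u a = 1

/-- `f_{Y|Z}(y|z)` when `X` given `Z` has density `q`. -/
def mixYgivenZ (𝒳 𝒴 : Set ℝ) (f : ℝ × ℝ × ℝ → ℝ) (q : ℝ → ℝ → ℝ≥0∞) (y z : ℝ) : ℝ≥0∞ :=
  ∫⁻ x in 𝒳, q x z * pdfYgivenXZ 𝒴 f y x z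

/-- `P_{U|Z,Y}(u|z,y)` when `X` given `Z` has density `q`, `U` given `(X, Z)` has mass function `w`
and `U - X - Y | Z`, that is, the density of `(U, X, Y)` given `Z = z` is
`q(x|z) w(u|x,z) f_{Y|X,Z}(y|x,z)`. -/
def probUgivenYZ (𝒳 𝒴 : Set ℝ) (f : ℝ × ℝ × ℝ → ℝ) (q : ℝ → ℝ → ℝ≥0∞) {n : ℕ}
    (w : Fin n → ℝ × ℝ → ℝ≥0∞) (u : Fin n) (y z : ℝ) : ℝ≥0∞ :=
  (∫⁻ x in 𝒳, q x z * w u (x, z) * pdfYgivenXZ 𝒴 f y x z) / mixYgivenZ 𝒳 𝒴 f q y z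

/-- `P_{U|Z}(u|z)`. -/
def probUgivenZ (𝒳 : Set ℝ) (q : ℝ → ℝ → ℝ≥0∞) {n : ℕ}
    (w : Fin n → ℝ × ℝ → ℝ≥0∞) (u : Fin n) (z : ℝ) : ℝ≥0∞ :=
  ∫⁻ x in 𝒳, q x z * w u (x, z)

/-- The best expected gain of an adversary that guesses `U` from `(Z, Y)`. -/
def gainYZ (α β : ℝ) (𝒳 𝒴 𝒵 : Set ℝ) (f : ℝ × ℝ × ℝ → ℝ) (q : ℝ → ℝ → ℝ≥0∞) {n : ℕ}
    (w : Fin n → ℝ × ℝ → ℝ≥0∞) : ℝ≥0∞ :=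
  ⨆ (h : Fin n → ℝ × ℝ → ℝ≥0∞) (_ : IsCondPMF h),
    ∫⁻ z in 𝒵, pdfZ 𝒳 𝒴 f z * ∫⁻ y in 𝒴, mixYgivenZ 𝒳 𝒴 f q y z *
      (∑ u, probUgivenYZ 𝒳 𝒴 f q w u y z * h u (z, y) ^ ((α - 1) / α)) ^ β

/-- The best expected gain of an adversary that guesses `U` from `Z` only. -/
def gainZ (α β : ℝ) (𝒳 𝒴 𝒵 : Set ℝ) (f : ℝ × ℝ × ℝ → ℝ) (q : ℝ → ℝ → ℝ≥0∞) {n : ℕ}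
    (w : Fin n → ℝ × ℝ → ℝ≥0∞) : ℝ≥0∞ :=
  ⨆ (h : Fin n → ℝ → ℝ≥0∞) (_ : IsCondPMF h),
    ∫⁻ z in 𝒵, pdfZ 𝒳 𝒴 f z *
      (∑ u, probUgivenZ 𝒳 q w u z * h u z ^ ((α - 1) / α)) ^ β

/-- Conditional maximal `(α, β)`-leakage from `X` to `Y` given `Z`: the supremum over the
conditional densities `q` of `X` given `Z` and over the variables `U` with an arbitrary finite
alphabet such that `U - X - Y | Z`. -/
def leakage (α β : ℝ) (𝒳 𝒴 𝒵 : Set ℝ) (f : ℝ × ℝ × ℝ → ℝ) : EReal :=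
  ⨆ (q : ℝ → ℝ → ℝ≥0∞) (_ : IsCondPDF 𝒳 𝒴 𝒵 f q)
    (n : ℕ) (w : Fin n → ℝ × ℝ → ℝ≥0∞) (_ : IsCondPMF w),
    ((α / ((α - 1) * β) : ℝ) : EReal) *
      ENNReal.log (gainYZ α β 𝒳 𝒴 𝒵 f q w / gainZ α β 𝒳 𝒴 𝒵 f q w)

end CondLeakage

end

/-!
# The single-letter formula for conditional maximal `(α, β)`-leakage

Write `K(y|x,z)` for the channel `f_{Y|X,Z}` and `m(y|z)` for the density of `Y` given `Z = z` under
the input `q`. By Hölder's inequality the best estimator can be computed explicitly, and both gains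
become integrals over `z` with weight `f_Z`, of `∫ m ^ (1 - β) (∑ᵤ (∫ q wᵤ K) ^ α) ^ (β / α) dy` in
the numerator and of `(∑ᵤ pᵤ ^ α) ^ (β / α)` in the denominator, where `pᵤ = ∫ q wᵤ`
(`gainYZ_eq`, `gainZ_eq`).

*Upper bound* (`gainYZ_div_gainZ_le`). Hölder's inequality for each symbol gives
`(∫ q wᵤ K) ^ α ≤ pᵤ ^ (α - 1) ∫ q wᵤ K ^ α`, so the sum over `u` is at most `∑ᵤ pᵤ ^ α` times
`∫ K ^ α g` for the tilted density `g ∝ ∑ᵤ pᵤ ^ (α - 1) q wᵤ` (`exists_isPDFOn_sum_rpow_le`).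
Convexity of `t ↦ t ^ (1 - β)` gives `m ^ (1 - β) ≤ ∫ q K ^ (1 - β)`, and after exchanging the
integrals the numerator is an average over `x'` of the functional on the right-hand side.

*Lower bound* (`lintegral_density_le`). Fix `c`, a point `a₀` and finitely many points `a i` of the
support of `X` given `Z = c`. For `z` in a small set `A` around `c`, let the input be a mixture,
with weight `1 - ε` on a narrow density around `a₀` and weights `ε b i` on narrow densities around
the `a i`. The variable `U` reveals the component, except that the one around `a₀` is shared out
evenly among `M` symbols; for `z ∉ A` it is uniform. As `M → ∞`, the first component and all
`z ∉ A` disappear from the denominator because `α > 1` (`exists_mem_lintegral_le`), whereas for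
small `ε` the first component alone determines `m`, so `m ^ (1 - β)` tends to `K(y|a₀,c) ^ (1 - β)`.
Shrinking everything to `c`, `a₀` and `a i`, Fatou's lemma and the continuity of `K` yield the
inequality for discrete inputs (`lintegral_finite_points_le`). The hypotheses on the alphabets and
the continuity of `f` are what provides sets of positive measure near these points on which all
densities are available (`exists_measurableSet_suppX_inter_ball`). A general density `g` is reached
by approximating the identity of the support by simple functions and using Fatou's lemma again.
-/

namespace CondLeakage

/-! ### Hölder and Jensen inequalities -/

/-- Hölder's inequality bounds the conditional gain of every estimator `h` when the posterior mass
function is `p`. -/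
theorem sum_mul_rpow_le {ι : Type*} [Fintype ι] {α : ℝ} (hα : 1 < α) (p h : ι → ℝ≥0∞)
    (hh : ∑ u, h u = 1) :
    ∑ u, p u * h u ^ ((α - 1) / α) ≤ (∑ u, p u ^ α) ^ (1 / α) := by
  have hconj : α.HolderConjugate (α / (α - 1)) := Real.HolderConjugate.conjExponent hα
  have h1 : α - 1 ≠ 0 := by linarith
  have h0 : α ≠ 0 := by linarith
  refine (ENNReal.inner_le_Lp_mul_Lq Finset.univ p (fun u => h u ^ ((α - 1) / α)) hconj).trans ?_
  have : ∀ u, (h u ^ ((α - 1) / α)) ^ (α / (α - 1)) = h u := fun u => by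
    rw [← ENNReal.rpow_mul, div_mul_div_cancel₀ h0, div_self h1, ENNReal.rpow_one]
  simp [this, hh]

/-- The estimator proportional to `p u ^ α` attains the Hölder bound, and it is measurable in the
observation. -/
theorem exists_isCondPMF_sum_mul_rpow_eq {A : Type} [MeasurableSpace A] {n : ℕ} (hn : n ≠ 0)
    {α : ℝ} (hα : 1 < α) {p : Fin n → A → ℝ≥0∞} (hp : ∀ u, Measurable (p u)) :
    ∃ h : Fin n → A → ℝ≥0∞, IsCondPMF h ∧
      ∀ a, ∑ u, p u a * h u a ^ ((α - 1) / α) = (∑ u, p u a ^ α) ^ (1 / α) := by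
  have hα0 : 0 < α := by linarith
  have hS : Measurable fun a => ∑ u, p u a ^ α :=
    Finset.measurable_sum _ fun u _ => (hp u).pow_const α
  have hB : MeasurableSet {a | ∑ u, p u a ^ α ≠ 0 ∧ ∑ u, p u a ^ α ≠ ∞} :=
    (hS (measurableSet_singleton 0).compl).inter (hS (measurableSet_singleton ∞).compl)
  classical
  refine ⟨fun u a => if ∑ u, p u a ^ α ≠ 0 ∧ ∑ u, p u a ^ α ≠ ∞ then
      p u a ^ α / ∑ u, p u a ^ α else (n : ℝ≥0∞)⁻¹, ⟨fun u => ?_, fun a => ?_⟩, fun a => ?_⟩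
  · exact Measurable.ite hB (((hp u).pow_const α).div hS) measurable_const
  · by_cases h : ∑ u, p u a ^ α ≠ 0 ∧ ∑ u, p u a ^ α ≠ ∞
    · simp only [if_pos h]
      simp only [div_eq_mul_inv]
      rw [← Finset.sum_mul, ENNReal.mul_inv_cancel h.1 h.2]
    · simp only [if_neg h]
      simp [ENNReal.mul_inv_cancel, hn]
  · by_cases h : ∑ u, p u a ^ α ≠ 0 ∧ ∑ u, p u a ^ α ≠ ∞
    · simp only [if_pos h]
      set S := ∑ u, p u a ^ α with hSdef
      have key : ∀ u, p u a * (p u a ^ α / S) ^ ((α - 1) / α) =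
          p u a ^ α * (S ^ ((α - 1) / α))⁻¹ := fun u => by
        rw [ENNReal.div_rpow_of_nonneg _ _ (by apply div_nonneg <;> linarith), ← ENNReal.rpow_mul,
          mul_div_cancel₀ _ hα0.ne', div_eq_mul_inv, ← mul_assoc]
        congr 1
        conv_lhs => enter [1]; rw [← ENNReal.rpow_one (p u a)]
        rw [← ENNReal.rpow_add_of_nonneg _ _ zero_le_one (by linarith)]
        ring_nf
      simp only [key]
      rw [← Finset.sum_mul, ← hSdef, ← ENNReal.rpow_neg]
      conv_lhs => enter [1]; rw [← ENNReal.rpow_one S]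
      rw [← ENNReal.rpow_add _ _ h.1 h.2]
      congr 1
      field_simp
      ring
    · simp only [if_neg h]
      rw [← Finset.sum_mul]
      by_cases h0 : ∑ u, p u a ^ α = 0
      · have : ∀ u, p u a = 0 := fun u => by
          have := (Finset.sum_eq_zero_iff.1 h0) u (Finset.mem_univ u)
          simpa [ENNReal.rpow_eq_zero_iff, hα0, hα0.not_gt] using this
        simp [this, hα0]
      · have hT : ∑ u, p u a ^ α = ∞ := by by_contra h2; exact h ⟨h0, h2⟩
        obtain ⟨u, -, hu⟩ := ENNReal.sum_eq_top.1 hT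
        have hu' : p u a = ∞ := by
          simpa [ENNReal.rpow_eq_top_iff, hα0, hα0.not_gt] using hu
        have : ∑ u, p u a = ∞ := ENNReal.sum_eq_top.2 ⟨u, Finset.mem_univ u, hu'⟩
        rw [hT, this, ENNReal.top_rpow_of_pos (by positivity), ENNReal.top_mul]
        refine (ENNReal.rpow_pos ?_ ?_).ne' <;> simp [hn]

/-- Jensen's inequality for `t ↦ t ^ α` and the measure with density `v`, not necessarily of
mass one. -/
theorem rpow_lintegral_mul_le {A : Type*} [MeasurableSpace A] {μ : Measure A} {α : ℝ} (hα : 1 < α)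
    {v k : A → ℝ≥0∞} (hv : AEMeasurable v μ) (hk : AEMeasurable k μ) :
    (∫⁻ x, v x * k x ∂μ) ^ α ≤ (∫⁻ x, v x ∂μ) ^ (α - 1) * ∫⁻ x, v x * k x ^ α ∂μ := by
  have hα0 : 0 < α := by linarith
  have hconj : (α / (α - 1)).HolderConjugate α := (Real.HolderConjugate.conjExponent hα).symm
  have h1 : α - 1 ≠ 0 := by linarith
  -- Hölder's inequality for `v k = v ^ ((α - 1) / α) * (v ^ (1 / α) k)`
  have H := ENNReal.lintegral_mul_le_Lp_mul_Lq μ hconj (hv.pow_const ((α - 1) / α))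
    ((hv.pow_const (1 / α)).mul hk)
  have e1 : ∀ x, ((fun x => v x ^ ((α - 1) / α)) * ((fun x => v x ^ (1 / α)) * k)) x
      = v x * k x := fun x => by
    simp only [Pi.mul_apply]
    rw [← mul_assoc, ← ENNReal.rpow_add_of_nonneg _ _ (by apply div_nonneg <;> linarith)
      (by positivity), ← add_div, sub_add_cancel, div_self hα0.ne', ENNReal.rpow_one]
  have e2 : ∀ x, (v x ^ ((α - 1) / α)) ^ (α / (α - 1)) = v x := fun x => by
    rw [← ENNReal.rpow_mul, div_mul_div_cancel₀ hα0.ne', div_self h1, ENNReal.rpow_one]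
  have e3 : ∀ x, (((fun x => v x ^ (1 / α)) * k) x) ^ α = v x * k x ^ α := fun x => by
    simp only [Pi.mul_apply]
    rw [ENNReal.mul_rpow_of_nonneg _ _ hα0.le, ← ENNReal.rpow_mul, div_mul_cancel₀ _ hα0.ne',
      ENNReal.rpow_one]
  simp only [e1, e2, e3] at H
  refine (ENNReal.rpow_le_rpow H hα0.le).trans_eq ?_
  rw [ENNReal.mul_rpow_of_nonneg _ _ hα0.le, ← ENNReal.rpow_mul, ← ENNReal.rpow_mul,
    div_mul_cancel₀ _ hα0.ne', ENNReal.rpow_one]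
  congr 2
  field_simp

/-- Jensen's inequality for `t ↦ t ^ (1 - β)`, with `0 ^ (1 - β) = ∞` for `1 < β`. -/
theorem rpow_one_sub_lintegral_le {A : Type*} [MeasurableSpace A] {μ : Measure A} {β : ℝ}
    (hβ : 1 ≤ β) {v k : A → ℝ≥0∞} (hv : AEMeasurable v μ) (hk : AEMeasurable k μ)
    (hv1 : ∫⁻ x, v x ∂μ = 1) (hfin : ∀ x, v x ≠ 0 → k x ≠ ∞) :
    (∫⁻ x, v x * k x ∂μ) ^ (1 - β) ≤ ∫⁻ x, v x * k x ^ (1 - β) ∂μ := by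
  rcases hβ.eq_or_lt with rfl | hβ1
  · simp [hv1]
  by_cases htop : ∫⁻ x, v x * k x ^ (1 - β) ∂μ = ∞
  · rw [htop]; exact le_top
  have hβ0 : 0 < β := by linarith
  have h1 : β - 1 ≠ 0 := by linarith
  have hconj : (β / (β - 1)).HolderConjugate β := (Real.HolderConjugate.conjExponent hβ1).symm
  -- Hölder's inequality for `v = (v k) ^ ((β - 1) / β) * (v k ^ (1 - β)) ^ (1 / β)`, which holds
  -- almost everywhere because the right-hand side is finite
  have H := ENNReal.lintegral_mul_le_Lp_mul_Lq μ hconj ((hv.mul hk).pow_const ((β - 1) / β))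
    ((hv.mul (hk.pow_const (1 - β))).pow_const (1 / β))
  have e1 : ∫⁻ x, ((fun x => (v * k) x ^ ((β - 1) / β)) *
      (fun x => (v * fun x => k x ^ (1 - β)) x ^ (1 / β))) x ∂μ = 1 := by
    rw [← hv1]
    refine lintegral_congr_ae ?_
    filter_upwards [ae_lt_top' (hv.mul (hk.pow_const (1 - β))) htop] with x hx
    simp only [Pi.mul_apply] at hx ⊢
    by_cases hvx : v x = 0
    · simp [hvx, hβ0]
    have hkx : k x ≠ 0 := by
      intro h0
      rw [h0, ENNReal.zero_rpow_of_neg (by linarith), ENNReal.mul_top hvx] at hx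
      exact lt_irrefl _ hx
    rw [ENNReal.mul_rpow_of_nonneg _ _ (by apply div_nonneg <;> linarith),
      ENNReal.mul_rpow_of_nonneg _ _ (by positivity), mul_mul_mul_comm,
      ← ENNReal.rpow_add_of_nonneg _ _ (by apply div_nonneg <;> linarith)
      (by positivity), ← add_div, sub_add_cancel, div_self hβ0.ne', ENNReal.rpow_one,
      ← ENNReal.rpow_mul, ← ENNReal.rpow_add _ _ hkx (hfin x hvx)]
    have : (β - 1) / β + (1 - β) * (1 / β) = 0 := by field_simp; ring
    rw [this, ENNReal.rpow_zero, mul_one]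
  have e2 : ∀ x, ((v * k) x ^ ((β - 1) / β)) ^ (β / (β - 1)) = v x * k x := fun x => by
    rw [← ENNReal.rpow_mul, div_mul_div_cancel₀ hβ0.ne', div_self h1, ENNReal.rpow_one]
    rfl
  have e3 : ∀ x, ((v * fun x => k x ^ (1 - β)) x ^ (1 / β)) ^ β = v x * k x ^ (1 - β) :=
    fun x => by
      rw [← ENNReal.rpow_mul, div_mul_cancel₀ _ hβ0.ne', ENNReal.rpow_one]; rfl
  rw [e1] at H
  simp only [e2, e3] at H
  have H2 := ENNReal.rpow_le_rpow H hβ0.le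
  rw [ENNReal.one_rpow, ENNReal.mul_rpow_of_nonneg _ _ hβ0.le, ← ENNReal.rpow_mul,
    ← ENNReal.rpow_mul, div_mul_cancel₀ _ hβ0.ne', ENNReal.rpow_one] at H2
  have e4 : 1 / (β / (β - 1)) * β = β - 1 := by field_simp
  rw [e4, mul_comm] at H2
  have := ENNReal.div_le_of_le_mul H2
  rwa [one_div, ← ENNReal.rpow_neg, neg_sub] at this

/-! ### Densities, supports and their measurability -/

section Congr

variable {𝒳 𝒴 𝒵 : Set ℝ} {f g : ℝ × ℝ × ℝ → ℝ}

theorem pdfXZ_congr (h𝒴 : MeasurableSet 𝒴) (h : EqOn f g (𝒳 ×ˢ 𝒴 ×ˢ 𝒵)) {x z : ℝ} (hx : x ∈ 𝒳)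
    (hz : z ∈ 𝒵) : pdfXZ 𝒴 f x z = pdfXZ 𝒴 g x z :=
  setLIntegral_congr_fun h𝒴 fun y hy => by simp only [h (show (x, y, z) ∈ _ from ⟨hx, hy, hz⟩)]

theorem pdfZ_congr (h𝒳 : MeasurableSet 𝒳) (h𝒴 : MeasurableSet 𝒴)
    (h : EqOn f g (𝒳 ×ˢ 𝒴 ×ˢ 𝒵)) {z : ℝ} (hz : z ∈ 𝒵) : pdfZ 𝒳 𝒴 f z = pdfZ 𝒳 𝒴 g z :=
  setLIntegral_congr_fun h𝒳 fun _ hx => pdfXZ_congr h𝒴 h hx hz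

theorem suppZ_congr (h𝒳 : MeasurableSet 𝒳) (h𝒴 : MeasurableSet 𝒴)
    (h : EqOn f g (𝒳 ×ˢ 𝒴 ×ˢ 𝒵)) : suppZ 𝒳 𝒴 𝒵 f = suppZ 𝒳 𝒴 𝒵 g := by
  ext z
  simp only [suppZ, mem_ofPred_eq]
  exact and_congr_right fun hz => by rw [pdfZ_congr h𝒳 h𝒴 h hz]

theorem suppX_congr (h𝒳 : MeasurableSet 𝒳) (h𝒴 : MeasurableSet 𝒴)
    (h : EqOn f g (𝒳 ×ˢ 𝒴 ×ˢ 𝒵)) {z : ℝ} (hz : z ∈ 𝒵) : suppX 𝒳 𝒴 f z = suppX 𝒳 𝒴 g z := by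
  ext x
  simp only [suppX, mem_ofPred_eq, pdfXgivenZ]
  exact and_congr_right fun hx => by rw [pdfZ_congr h𝒳 h𝒴 h hz, pdfXZ_congr h𝒴 h hx hz]

theorem pdfYgivenXZ_congr (h𝒴 : MeasurableSet 𝒴) (h : EqOn f g (𝒳 ×ˢ 𝒴 ×ˢ 𝒵)) {x y z : ℝ}
    (hx : x ∈ 𝒳) (hy : y ∈ 𝒴) (hz : z ∈ 𝒵) :
    pdfYgivenXZ 𝒴 f y x z = pdfYgivenXZ 𝒴 g y x z := by
  rw [pdfYgivenXZ, pdfYgivenXZ, pdfXZ_congr h𝒴 h hx hz,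
    h (show (x, y, z) ∈ _ from ⟨hx, hy, hz⟩)]

theorem mixYgivenZ_congr (h𝒳 : MeasurableSet 𝒳) (h𝒴 : MeasurableSet 𝒴)
    (h : EqOn f g (𝒳 ×ˢ 𝒴 ×ˢ 𝒵)) (q : ℝ → ℝ → ℝ≥0∞) {y z : ℝ} (hy : y ∈ 𝒴) (hz : z ∈ 𝒵) :
    mixYgivenZ 𝒳 𝒴 f q y z = mixYgivenZ 𝒳 𝒴 g q y z :=
  setLIntegral_congr_fun h𝒳 fun x hx => by simp only [pdfYgivenXZ_congr h𝒴 h hx hy hz]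

theorem probUgivenYZ_congr (h𝒳 : MeasurableSet 𝒳) (h𝒴 : MeasurableSet 𝒴)
    (h : EqOn f g (𝒳 ×ˢ 𝒴 ×ˢ 𝒵)) (q : ℝ → ℝ → ℝ≥0∞) {n : ℕ} (w : Fin n → ℝ × ℝ → ℝ≥0∞)
    (u : Fin n) {y z : ℝ} (hy : y ∈ 𝒴) (hz : z ∈ 𝒵) :
    probUgivenYZ 𝒳 𝒴 f q w u y z = probUgivenYZ 𝒳 𝒴 g q w u y z := by
  rw [probUgivenYZ, probUgivenYZ, mixYgivenZ_congr h𝒳 h𝒴 h q hy hz]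
  congr 1
  exact setLIntegral_congr_fun h𝒳 fun x hx => by simp only [pdfYgivenXZ_congr h𝒴 h hx hy hz]

theorem gainYZ_congr (h𝒳 : MeasurableSet 𝒳) (h𝒴 : MeasurableSet 𝒴) (h𝒵 : MeasurableSet 𝒵)
    (h : EqOn f g (𝒳 ×ˢ 𝒴 ×ˢ 𝒵)) (α β : ℝ) (q : ℝ → ℝ → ℝ≥0∞) {n : ℕ}
    (w : Fin n → ℝ × ℝ → ℝ≥0∞) :
    gainYZ α β 𝒳 𝒴 𝒵 f q w = gainYZ α β 𝒳 𝒴 𝒵 g q w := by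
  refine iSup_congr fun v => iSup_congr fun _ => setLIntegral_congr_fun h𝒵 fun z hz => ?_
  simp only [pdfZ_congr h𝒳 h𝒴 h hz]
  congr 1
  refine setLIntegral_congr_fun h𝒴 fun y hy => ?_
  simp only [mixYgivenZ_congr h𝒳 h𝒴 h q hy hz, probUgivenYZ_congr h𝒳 h𝒴 h q w _ hy hz]

theorem gainZ_congr (h𝒳 : MeasurableSet 𝒳) (h𝒴 : MeasurableSet 𝒴) (h𝒵 : MeasurableSet 𝒵)
    (h : EqOn f g (𝒳 ×ˢ 𝒴 ×ˢ 𝒵)) (α β : ℝ) (q : ℝ → ℝ → ℝ≥0∞) {n : ℕ}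
    (w : Fin n → ℝ × ℝ → ℝ≥0∞) :
    gainZ α β 𝒳 𝒴 𝒵 f q w = gainZ α β 𝒳 𝒴 𝒵 g q w :=
  iSup_congr fun v => iSup_congr fun _ => setLIntegral_congr_fun h𝒵 fun z hz => by
    simp only [pdfZ_congr h𝒳 h𝒴 h hz]

theorem isCondPDF_congr (h𝒳 : MeasurableSet 𝒳) (h𝒴 : MeasurableSet 𝒴)
    (h : EqOn f g (𝒳 ×ˢ 𝒴 ×ˢ 𝒵)) {q : ℝ → ℝ → ℝ≥0∞} (hq : IsCondPDF 𝒳 𝒴 𝒵 f q) :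
    IsCondPDF 𝒳 𝒴 𝒵 g q :=
  ⟨hq.measurable, fun z hz => by
    have hz' : z ∈ suppZ 𝒳 𝒴 𝒵 f := by rwa [suppZ_congr h𝒳 h𝒴 h]
    rw [← suppX_congr h𝒳 h𝒴 h hz.1]
    exact hq.isPDFOn z hz'⟩

end Congr

section Measurability

variable {𝒳 𝒴 𝒵 : Set ℝ} {f : ℝ × ℝ × ℝ → ℝ}

theorem measurable_pdfXZ (hf : Measurable f) :
    Measurable fun p : ℝ × ℝ => pdfXZ 𝒴 f p.1 p.2 := by
  unfold pdfXZ
  refine Measurable.lintegral_prod_right' (f := fun p : (ℝ × ℝ) × ℝ =>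
    ENNReal.ofReal (f (p.1.1, p.2, p.1.2))) ?_
  fun_prop

theorem measurable_pdfZ (hf : Measurable f) : Measurable (pdfZ 𝒳 𝒴 f) :=
  Measurable.lintegral_prod_left' (f := fun p : ℝ × ℝ => pdfXZ 𝒴 f p.1 p.2) (measurable_pdfXZ hf)

theorem measurable_pdfXgivenZ (hf : Measurable f) :
    Measurable fun p : ℝ × ℝ => pdfXgivenZ 𝒳 𝒴 f p.1 p.2 :=
  (measurable_pdfXZ hf).div ((measurable_pdfZ hf).comp measurable_snd)

theorem measurable_pdfYgivenXZ (hf : Measurable f) :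
    Measurable fun p : ℝ × ℝ × ℝ => pdfYgivenXZ 𝒴 f p.1 p.2.1 p.2.2 := by
  unfold pdfYgivenXZ
  refine Measurable.div (by fun_prop) ?_
  exact (measurable_pdfXZ hf).comp measurable_snd

theorem measurableSet_mem_suppX (hf : Measurable f) (h𝒳 : MeasurableSet 𝒳) :
    MeasurableSet {p : ℝ × ℝ | p.1 ∈ suppX 𝒳 𝒴 f p.2} :=
  (measurable_fst h𝒳).inter ((measurableSet_lt measurable_const (measurable_pdfXgivenZ hf)).inter
    (measurableSet_lt (measurable_pdfXgivenZ hf) measurable_const))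

theorem measurableSet_suppX (hf : Measurable f) (h𝒳 : MeasurableSet 𝒳) (z : ℝ) :
    MeasurableSet (suppX 𝒳 𝒴 f z) :=
  (measurableSet_mem_suppX (𝒴 := 𝒴) hf h𝒳).preimage
    (f := fun x : ℝ => (x, z)) (by fun_prop)

theorem measurable_lintegral_mul_pdfYgivenXZ (hf : Measurable f) {v : ℝ × ℝ → ℝ≥0∞}
    (hv : Measurable v) :
    Measurable fun p : ℝ × ℝ => ∫⁻ x in 𝒳, v (x, p.2) * pdfYgivenXZ 𝒴 f p.1 x p.2 := by
  refine Measurable.lintegral_prod_right' (f := fun p : (ℝ × ℝ) × ℝ =>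
    v (p.2, p.1.2) * pdfYgivenXZ 𝒴 f p.1.1 p.2 p.1.2) ?_
  refine (hv.comp (by fun_prop)).mul ?_
  exact (measurable_pdfYgivenXZ hf).comp (g := fun p => pdfYgivenXZ 𝒴 f p.1 p.2.1 p.2.2)
    (f := fun p : (ℝ × ℝ) × ℝ => (p.1.1, p.2, p.1.2)) (by fun_prop)

theorem measurable_mixYgivenZ (hf : Measurable f) {q : ℝ → ℝ → ℝ≥0∞}
    (hq : Measurable fun p : ℝ × ℝ => q p.1 p.2) :
    Measurable fun p : ℝ × ℝ => mixYgivenZ 𝒳 𝒴 f q p.1 p.2 :=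
  measurable_lintegral_mul_pdfYgivenXZ hf hq

theorem measurable_probUgivenYZ (hf : Measurable f) {q : ℝ → ℝ → ℝ≥0∞}
    (hq : Measurable fun p : ℝ × ℝ => q p.1 p.2) {n : ℕ} {w : Fin n → ℝ × ℝ → ℝ≥0∞} {u : Fin n}
    (hw : Measurable (w u)) :
    Measurable fun p : ℝ × ℝ => probUgivenYZ 𝒳 𝒴 f q w u p.1 p.2 :=
  (measurable_lintegral_mul_pdfYgivenXZ hf (v := fun p => q p.1 p.2 * w u p) (hq.mul hw)).div
    (measurable_mixYgivenZ hf hq)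

theorem measurable_probUgivenZ {q : ℝ → ℝ → ℝ≥0∞}
    (hq : Measurable fun p : ℝ × ℝ => q p.1 p.2) {n : ℕ} {w : Fin n → ℝ × ℝ → ℝ≥0∞} {u : Fin n}
    (hw : Measurable (w u)) : Measurable fun z : ℝ => probUgivenZ 𝒳 q w u z :=
  Measurable.lintegral_prod_left' (f := fun p : ℝ × ℝ => q p.1 p.2 * w u p) (hq.mul hw)

end Measurability

section Supports

variable {𝒳 𝒴 𝒵 : Set ℝ} {f : ℝ × ℝ × ℝ → ℝ}

theorem suppX_subset (z : ℝ) : suppX 𝒳 𝒴 f z ⊆ 𝒳 := fun _ h => h.1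

theorem mem_suppX_iff {z : ℝ} (hz : z ∈ suppZ 𝒳 𝒴 𝒵 f) {x : ℝ} :
    x ∈ suppX 𝒳 𝒴 f z ↔ x ∈ 𝒳 ∧ 0 < pdfXZ 𝒴 f x z ∧ pdfXZ 𝒴 f x z < ∞ := by
  have h0 := hz.2.1.ne'
  have h1 := hz.2.2.ne
  simp only [suppX, pdfXgivenZ, mem_ofPred_eq, lt_top_iff_ne_top,
    pos_iff_ne_zero, Ne, ENNReal.div_eq_zero_iff, ENNReal.div_eq_top, h0, h1]
  tauto

theorem pdfYgivenXZ_ne_top {x y z : ℝ} (h : 0 < pdfXZ 𝒴 f x z) : pdfYgivenXZ 𝒴 f y x z ≠ ∞ :=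
  ENNReal.div_ne_top ENNReal.ofReal_ne_top h.ne'

theorem lintegral_pdfYgivenXZ (hf : Measurable f) {x z : ℝ} (h : 0 < pdfXZ 𝒴 f x z)
    (h' : pdfXZ 𝒴 f x z < ∞) : ∫⁻ y in 𝒴, pdfYgivenXZ 𝒴 f y x z = 1 := by
  simp only [pdfYgivenXZ, div_eq_mul_inv]
  rw [lintegral_mul_const _ (by fun_prop)]
  exact ENNReal.mul_inv_cancel h.ne' h'.ne

/-- The alphabet may be dropped from the domain of an average with respect to a density that lives
on a subset of it. -/
theorem IsPDFOn.setLIntegral_eq {S : Set ℝ} {g : ℝ → ℝ≥0∞} (hg : IsPDFOn S g) (hS : S ⊆ 𝒳)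
    (k : ℝ → ℝ≥0∞) : ∫⁻ x in 𝒳, g x * k x = ∫⁻ x, g x * k x := by
  refine setLIntegral_eq_of_support_subset ?_
  intro x hx
  by_contra h
  exact hx (by simp [hg.zero_off x fun h' => h (hS h')])

/-- The density of `Y` given `Z = z` under the input density `g` integrates to one; in particular it
is finite almost everywhere. -/
theorem lintegral_mixture (hf : Measurable f) {z : ℝ} (hz : z ∈ suppZ 𝒳 𝒴 𝒵 f)
    {g : ℝ → ℝ≥0∞} (hg : IsPDFOn (suppX 𝒳 𝒴 f z) g) :
    ∫⁻ y in 𝒴, ∫⁻ x in 𝒳, g x * pdfYgivenXZ 𝒴 f y x z = 1 := by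
  rw [lintegral_lintegral_swap]
  · have : ∀ x, ∫⁻ y in 𝒴, g x * pdfYgivenXZ 𝒴 f y x z = g x * 1 := fun x => by
      rw [lintegral_const_mul]
      · by_cases hx : x ∈ suppX 𝒳 𝒴 f z
        · have := (mem_suppX_iff hz).1 hx
          rw [lintegral_pdfYgivenXZ hf this.2.1 this.2.2]
        · simp [hg.zero_off x hx]
      · exact (measurable_pdfYgivenXZ hf).comp (by fun_prop : Measurable fun y : ℝ => (y, x, z))
    simp only [this]
    rw [hg.setLIntegral_eq (suppX_subset z) (fun _ => 1)]
    simpa using hg.lintegral_eq_one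
  · refine Measurable.aemeasurable ?_
    refine (hg.measurable.comp measurable_snd).mul ?_
    exact (measurable_pdfYgivenXZ hf).comp (by fun_prop : Measurable fun p : ℝ × ℝ => (p.1, p.2, z))

theorem lintegral_pdfZ {Ω : Type*} [MeasurableSpace Ω] {P : Measure Ω} [IsProbabilityMeasure P]
    {X Y Z : Ω → ℝ} (hf : Measurable f)
    (h : HasJointPDF P X Y Z 𝒳 𝒴 𝒵 f) : ∫⁻ z in 𝒵, pdfZ 𝒳 𝒴 f z = 1 := by
  have h1 : (P.map fun ω => (X ω, Y ω, Z ω)) univ = 1 := by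
    have := h.measurable_X
    have := h.measurable_Y
    have := h.measurable_Z
    rw [Measure.map_apply (by fun_prop) MeasurableSet.univ]
    simp
  rw [h.law, withDensity_apply _ MeasurableSet.univ, Measure.restrict_univ, Measure.volume_eq_prod,
    ← Measure.prod_restrict, Measure.volume_eq_prod, ← Measure.prod_restrict,
    lintegral_prod _ (by fun_prop)] at h1
  have h2 : ∀ x, ∫⁻ p, ENNReal.ofReal (f (x, p)) ∂(volume.restrict 𝒴).prod (volume.restrict 𝒵) =
      ∫⁻ z in 𝒵, pdfXZ 𝒴 f x z := fun x => by
    rw [lintegral_prod_symm _ (by fun_prop)]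
    rfl
  simp only [h2] at h1
  rw [← h1, lintegral_lintegral_swap]
  · rfl
  · exact (measurable_pdfXZ hf).aemeasurable

theorem ae_pdfXZ_lt_top (hf : Measurable f) {z : ℝ} (hz : pdfZ 𝒳 𝒴 f z ≠ ∞) :
    ∀ᵐ x ∂volume.restrict 𝒳, pdfXZ 𝒴 f x z < ∞ :=
  ae_lt_top ((measurable_pdfXZ hf).comp (by fun_prop : Measurable fun x : ℝ => (x, z))) hz

end Supports

/-! ### Closed form of the gains, and the upper bound -/

section Gains

variable {𝒳 𝒴 𝒵 : Set ℝ} {f : ℝ × ℝ × ℝ → ℝ} {α β : ℝ} {q : ℝ → ℝ → ℝ≥0∞} {n : ℕ}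
  {w : Fin n → ℝ × ℝ → ℝ≥0∞}

theorem IsCondPMF.ne_zero (hw : IsCondPMF w) : n ≠ 0 := by
  rintro rfl
  simpa using hw.sum_eq_one (0, 0)

/-- The supremum over the estimators that observe `(Z, Y)`, in closed form. -/
theorem gainYZ_eq (hα : 1 < α) (hβ : 0 ≤ β) (hf : Measurable f)
    (hq : Measurable fun p : ℝ × ℝ => q p.1 p.2) (hw : IsCondPMF w) :
    gainYZ α β 𝒳 𝒴 𝒵 f q w = ∫⁻ z in 𝒵, pdfZ 𝒳 𝒴 f z * ∫⁻ y in 𝒴, mixYgivenZ 𝒳 𝒴 f q y z *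
      (∑ u, probUgivenYZ 𝒳 𝒴 f q w u y z ^ α) ^ (β / α) := by
  have e : ∀ s : ℝ≥0∞, s ^ (β / α) = (s ^ (1 / α)) ^ β := fun s => by
    rw [← ENNReal.rpow_mul, one_div_mul_eq_div]
  simp only [e]
  apply le_antisymm
  · refine iSup₂_le fun h hh => ?_
    gcongr
    exact sum_mul_rpow_le hα _ _ (hh.sum_eq_one _)
  · obtain ⟨h, hh, hEq⟩ := exists_isCondPMF_sum_mul_rpow_eq (A := ℝ × ℝ) hw.ne_zero hα
      (p := fun u a => probUgivenYZ 𝒳 𝒴 f q w u a.2 a.1)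
      (fun u => (measurable_probUgivenYZ hf hq (hw.measurable u)).comp measurable_swap)
    refine le_iSup₂_of_le h hh (le_of_eq ?_)
    refine lintegral_congr fun z => congrArg _ (lintegral_congr fun y => ?_)
    rw [← hEq (z, y)]

/-- The supremum over the estimators that observe `Z`, in closed form. -/
theorem gainZ_eq (hα : 1 < α) (hβ : 0 ≤ β)
    (hq : Measurable fun p : ℝ × ℝ => q p.1 p.2) (hw : IsCondPMF w) :
    gainZ α β 𝒳 𝒴 𝒵 f q w = ∫⁻ z in 𝒵, pdfZ 𝒳 𝒴 f z *
      (∑ u, probUgivenZ 𝒳 q w u z ^ α) ^ (β / α) := by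
  have e : ∀ s : ℝ≥0∞, s ^ (β / α) = (s ^ (1 / α)) ^ β := fun s => by
    rw [← ENNReal.rpow_mul, one_div_mul_eq_div]
  simp only [e]
  apply le_antisymm
  · refine iSup₂_le fun h hh => ?_
    gcongr
    exact sum_mul_rpow_le hα _ _ (hh.sum_eq_one _)
  · obtain ⟨h, hh, hEq⟩ := exists_isCondPMF_sum_mul_rpow_eq hw.ne_zero hα
      (p := fun u z => probUgivenZ 𝒳 q w u z)
      (fun u => measurable_probUgivenZ hq (hw.measurable u))
    refine le_iSup₂_of_le h hh (le_of_eq ?_)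
    simp only [← hEq]

theorem sum_probUgivenZ (hw : IsCondPMF w) {S : Set ℝ} (hS : S ⊆ 𝒳) {z : ℝ}
    (hq : IsPDFOn S fun x => q x z) : ∑ u, probUgivenZ 𝒳 q w u z = 1 := by
  simp only [probUgivenZ]
  rw [← lintegral_finsetSum]
  · simp only [← Finset.mul_sum, hw.sum_eq_one]
    rw [hq.setLIntegral_eq hS fun _ => 1]
    simpa using hq.lintegral_eq_one
  · intro u _
    exact hq.measurable.mul ((hw.measurable u).comp (by fun_prop))

end Gains

section UpperBound

variable {𝒳 𝒴 𝒵 : Set ℝ} {f : ℝ × ℝ × ℝ → ℝ} {α β : ℝ} {q : ℝ → ℝ → ℝ≥0∞} {n : ℕ}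
  {w : Fin n → ℝ × ℝ → ℝ≥0∞}

theorem mul_sum_div_rpow {ι : Type*} [Fintype ι] (hα : 1 < α) (hβ : 1 ≤ β) {m : ℝ≥0∞}
    (hm0 : m ≠ 0) (hm : m ≠ ∞) (N : ι → ℝ≥0∞) :
    m * (∑ u, (N u / m) ^ α) ^ (β / α) = m ^ (1 - β) * (∑ u, N u ^ α) ^ (β / α) := by
  have hα0 : 0 < α := by linarith
  simp only [ENNReal.div_rpow_of_nonneg _ _ hα0.le]
  simp only [div_eq_mul_inv (_ ^ α)]
  rw [← Finset.sum_mul, ENNReal.mul_rpow_of_nonneg _ _ (by positivity), ← ENNReal.rpow_neg,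
    ← ENNReal.rpow_mul, mul_comm (Finset.sum _ _ ^ _), ← mul_assoc]
  congr 1
  conv_lhs => enter [1]; rw [← ENNReal.rpow_one m]
  rw [← ENNReal.rpow_add _ _ hm0 hm]
  congr 1
  field_simp
  ring

/-- Hölder's inequality, symbol by symbol: the vector of unnormalised posteriors of `U` is
dominated by one average of the `α`-th power of the channel, with respect to a tilted input
density `g` that does not depend on `y`. -/
theorem exists_isPDFOn_sum_rpow_le (hf : Measurable f) (hα : 1 < α) (hw : IsCondPMF w)
    {S : Set ℝ} (hS : S ⊆ 𝒳) {z : ℝ} (hq : IsPDFOn S fun x => q x z) :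
    ∃ g, IsPDFOn S g ∧ ∀ y,
      ∑ u, (∫⁻ x in 𝒳, q x z * w u (x, z) * pdfYgivenXZ 𝒴 f y x z) ^ α ≤
        (∑ u, probUgivenZ 𝒳 q w u z ^ α) * ∫⁻ x in 𝒳, pdfYgivenXZ 𝒴 f y x z ^ α * g x := by
  have hα0 : 0 < α := by linarith
  have hsum := sum_probUgivenZ hw hS hq
  set p : Fin n → ℝ≥0∞ := fun u => probUgivenZ 𝒳 q w u z with hp
  set T := ∑ u, p u ^ α with hT
  have hp1 : ∀ u, p u ≤ 1 := fun u => by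
    rw [← hsum]
    exact Finset.single_le_sum (f := p) (fun _ _ => zero_le) (Finset.mem_univ u)
  have hTtop : T ≠ ∞ := ENNReal.sum_ne_top.2 fun u _ =>
    ENNReal.rpow_ne_top_of_nonneg hα0.le (ne_top_of_le_ne_top ENNReal.one_ne_top (hp1 u))
  have hT0 : T ≠ 0 := by
    intro h0
    have : ∀ u, p u = 0 := fun u => by
      have := (Finset.sum_eq_zero_iff.1 h0) u (Finset.mem_univ u)
      simpa [ENNReal.rpow_eq_zero_iff, hα0, hα0.not_gt] using this
    rw [show (∑ u, probUgivenZ 𝒳 q w u z) = ∑ u, p u from rfl] at hsum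
    simp [this] at hsum
  have hvm : ∀ u, Measurable fun x => q x z * w u (x, z) := fun u =>
    hq.measurable.mul ((hw.measurable u).comp (by fun_prop))
  have hKm : ∀ y, Measurable fun x => pdfYgivenXZ 𝒴 f y x z := fun y =>
    (measurable_pdfYgivenXZ hf).comp (by fun_prop : Measurable fun x : ℝ => (y, x, z))
  have hpu : ∀ u, ∫⁻ x, q x z * w u (x, z) = p u := fun u =>
    (hq.setLIntegral_eq hS fun x => w u (x, z)).symm
  refine ⟨fun x => T⁻¹ * ∑ u, p u ^ (α - 1) * (q x z * w u (x, z)), ⟨?_, ?_, ?_⟩, fun y => ?_⟩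
  · exact (Finset.measurable_sum _ fun u _ => (hvm u).const_mul _).const_mul _
  · intro x hx
    simp [hq.zero_off x hx]
  · rw [lintegral_const_mul _ (Finset.measurable_sum _ fun u _ => (hvm u).const_mul _),
      lintegral_finsetSum _ fun u _ => (hvm u).const_mul _]
    simp only [lintegral_const_mul _ (hvm _), hpu]
    have : ∀ u, p u ^ (α - 1) * p u = p u ^ α := fun u => by
      conv_lhs => enter [2]; rw [← ENNReal.rpow_one (p u)]
      rw [← ENNReal.rpow_add_of_nonneg _ _ (by linarith) zero_le_one, sub_add_cancel]
    simp only [this]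
    exact ENNReal.inv_mul_cancel hT0 hTtop
  · calc ∑ u, (∫⁻ x in 𝒳, q x z * w u (x, z) * pdfYgivenXZ 𝒴 f y x z) ^ α
        ≤ ∑ u, p u ^ (α - 1) *
            ∫⁻ x in 𝒳, q x z * w u (x, z) * pdfYgivenXZ 𝒴 f y x z ^ α :=
          Finset.sum_le_sum fun u _ => rpow_lintegral_mul_le hα (hvm u).aemeasurable
            (hKm y).aemeasurable
      _ = ∫⁻ x in 𝒳, ∑ u, p u ^ (α - 1) *
            (q x z * w u (x, z) * pdfYgivenXZ 𝒴 f y x z ^ α) := by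
          have hvK : ∀ u, Measurable fun x =>
              q x z * w u (x, z) * pdfYgivenXZ 𝒴 f y x z ^ α :=
            fun u => (hvm u).mul ((hKm y).pow_const α)
          rw [lintegral_finsetSum _ fun u _ => (hvK u).const_mul _]
          simp only [lintegral_const_mul _ (hvK _)]
      _ = ∫⁻ x in 𝒳, T * (pdfYgivenXZ 𝒴 f y x z ^ α *
            (T⁻¹ * ∑ u, p u ^ (α - 1) * (q x z * w u (x, z)))) := by
          refine lintegral_congr fun x => ?_
          rw [mul_left_comm, ← mul_assoc T, ENNReal.mul_inv_cancel hT0 hTtop, one_mul,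
            Finset.mul_sum]
          exact Finset.sum_congr rfl fun u _ => by ring
      _ = _ := by
          rw [lintegral_const_mul]
          exact ((hKm y).pow_const α).mul
            ((Finset.measurable_sum _ fun u _ => (hvm u).const_mul _).const_mul _)

/-- For a fixed `z`, the conditional gain from `Y` is at most a bound `C` of the functional on the
right-hand side of the formula, times the conditional gain without `Y`. -/
theorem lintegral_gain_le (hf : Measurable f) (hα : 1 < α) (hβ : 1 ≤ β) (hw : IsCondPMF w)
    {z : ℝ} (hz : z ∈ suppZ 𝒳 𝒴 𝒵 f) (hq : IsPDFOn (suppX 𝒳 𝒴 f z) fun x => q x z) {C : ℝ≥0∞}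
    (hC : ∀ x' ∈ suppX 𝒳 𝒴 f z, ∀ g, IsPDFOn (suppX 𝒳 𝒴 f z) g →
      ∫⁻ y in 𝒴, pdfYgivenXZ 𝒴 f y x' z ^ (1 - β) *
        (∫⁻ x in 𝒳, pdfYgivenXZ 𝒴 f y x z ^ α * g x) ^ (β / α) ≤ C) :
    ∫⁻ y in 𝒴, mixYgivenZ 𝒳 𝒴 f q y z * (∑ u, probUgivenYZ 𝒳 𝒴 f q w u y z ^ α) ^ (β / α) ≤
      C * (∑ u, probUgivenZ 𝒳 q w u z ^ α) ^ (β / α) := by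
  have hβα : 0 ≤ β / α := by apply div_nonneg <;> linarith
  obtain ⟨g, hg, hgle⟩ := exists_isPDFOn_sum_rpow_le (𝒴 := 𝒴) hf hα hw (suppX_subset z) hq
  set T := ∑ u, probUgivenZ 𝒳 q w u z ^ α with hT
  have hK2 : Measurable fun p : ℝ × ℝ => pdfYgivenXZ 𝒴 f p.1 p.2 z :=
    (measurable_pdfYgivenXZ hf).comp (by fun_prop : Measurable fun p : ℝ × ℝ => (p.1, p.2, z))
  have hKm : ∀ y, Measurable fun x => pdfYgivenXZ 𝒴 f y x z := fun y =>
    hK2.comp (by fun_prop : Measurable fun x : ℝ => (y, x))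
  have hmm : Measurable fun y => mixYgivenZ 𝒳 𝒴 f q y z := by
    refine Measurable.lintegral_prod_right' (f := fun p : ℝ × ℝ =>
      q p.2 z * pdfYgivenXZ 𝒴 f p.1 p.2 z) ?_
    exact (hq.measurable.comp measurable_snd).mul hK2
  set G : ℝ → ℝ≥0∞ := fun y => ∫⁻ x in 𝒳, pdfYgivenXZ 𝒴 f y x z ^ α * g x with hG
  have hGm : Measurable G := by
    refine Measurable.lintegral_prod_right' (f := fun p : ℝ × ℝ =>
      pdfYgivenXZ 𝒴 f p.1 p.2 z ^ α * g p.2) ?_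
    exact (hK2.pow_const α).mul (hg.measurable.comp measurable_snd)
  have hmfin : ∀ᵐ y ∂volume.restrict 𝒴, mixYgivenZ 𝒳 𝒴 f q y z < ∞ := by
    refine ae_lt_top hmm ?_
    have := lintegral_mixture hf hz hq
    rw [show ∫⁻ y in 𝒴, mixYgivenZ 𝒳 𝒴 f q y z = 1 from this]
    exact ENNReal.one_ne_top
  calc ∫⁻ y in 𝒴, mixYgivenZ 𝒳 𝒴 f q y z * (∑ u, probUgivenYZ 𝒳 𝒴 f q w u y z ^ α) ^ (β / α)
      ≤ ∫⁻ y in 𝒴, T ^ (β / α) *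
          ∫⁻ x in 𝒳, q x z * (pdfYgivenXZ 𝒴 f y x z ^ (1 - β) * G y ^ (β / α)) := by
        refine lintegral_mono_ae ?_
        filter_upwards [hmfin] with y hy
        by_cases hm0 : mixYgivenZ 𝒳 𝒴 f q y z = 0
        · simp [hm0]
        simp only [probUgivenYZ]
        rw [mul_sum_div_rpow hα hβ hm0 hy.ne]
        have h1 : mixYgivenZ 𝒳 𝒴 f q y z ^ (1 - β) ≤
            ∫⁻ x in 𝒳, q x z * pdfYgivenXZ 𝒴 f y x z ^ (1 - β) := by
          refine rpow_one_sub_lintegral_le hβ hq.measurable.aemeasurable (hKm y).aemeasurable ?_ ?_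
          · have := hq.setLIntegral_eq (suppX_subset z) fun _ => 1
            simpa [hq.lintegral_eq_one] using this
          · intro x hx
            refine pdfYgivenXZ_ne_top ?_
            by_contra h
            refine hx (hq.zero_off x fun h' => h ((mem_suppX_iff hz).1 h').2.1)
        have h2 := ENNReal.rpow_le_rpow (hgle y) hβα
        rw [ENNReal.mul_rpow_of_nonneg _ _ hβα] at h2
        refine (mul_le_mul' h1 h2).trans_eq ?_
        have hqK : Measurable fun x => q x z * pdfYgivenXZ 𝒴 f y x z ^ (1 - β) :=
          hq.measurable.mul ((hKm y).pow_const _)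
        simp only [← mul_assoc]
        rw [lintegral_mul_const _ hqK, mul_comm _ (T ^ _), mul_assoc]
    _ = T ^ (β / α) * ∫⁻ x in 𝒳, q x z *
          ∫⁻ y in 𝒴, pdfYgivenXZ 𝒴 f y x z ^ (1 - β) * G y ^ (β / α) := by
        have hm2 : Measurable fun p : ℝ × ℝ =>
            q p.2 z * (pdfYgivenXZ 𝒴 f p.1 p.2 z ^ (1 - β) * G p.1 ^ (β / α)) :=
          (hq.measurable.comp measurable_snd).mul
            ((hK2.pow_const _).mul ((hGm.comp measurable_fst).pow_const _))
        rw [lintegral_const_mul _ hm2.lintegral_prod_right', lintegral_lintegral_swap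
          hm2.aemeasurable]
        congr 1
        refine lintegral_congr fun x => lintegral_const_mul (q x z)
          (f := fun y => pdfYgivenXZ 𝒴 f y x z ^ (1 - β) * G y ^ (β / α)) ?_
        exact ((hK2.comp (by fun_prop : Measurable fun y : ℝ => (y, x))).pow_const _).mul
          (hGm.pow_const _)
    _ ≤ T ^ (β / α) * ∫⁻ x in 𝒳, q x z * C := by
        refine mul_le_mul' le_rfl (lintegral_mono fun x => ?_)
        by_cases hx : x ∈ suppX 𝒳 𝒴 f z
        · exact mul_le_mul' le_rfl (hC x hx g hg)
        · simp only [hq.zero_off x hx, zero_mul, le_refl]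
    _ = C * T ^ (β / α) := by
        rw [hq.setLIntegral_eq (suppX_subset z) fun _ => C, lintegral_mul_const _ hq.measurable,
          hq.lintegral_eq_one, one_mul, mul_comm]

theorem gainYZ_div_gainZ_le (hf : Measurable f) (h𝒵 : MeasurableSet 𝒵) (hα : 1 < α) (hβ : 1 ≤ β)
    (hZ : ∫⁻ z in 𝒵, pdfZ 𝒳 𝒴 f z ≠ ∞) (hq : IsCondPDF 𝒳 𝒴 𝒵 f q) (hw : IsCondPMF w)
    {C : ℝ≥0∞}
    (hC : ∀ z ∈ suppZ 𝒳 𝒴 𝒵 f, ∀ x' ∈ suppX 𝒳 𝒴 f z, ∀ g, IsPDFOn (suppX 𝒳 𝒴 f z) g →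
      ∫⁻ y in 𝒴, pdfYgivenXZ 𝒴 f y x' z ^ (1 - β) *
        (∫⁻ x in 𝒳, pdfYgivenXZ 𝒴 f y x z ^ α * g x) ^ (β / α) ≤ C) :
    gainYZ α β 𝒳 𝒴 𝒵 f q w / gainZ α β 𝒳 𝒴 𝒵 f q w ≤ C := by
  have hm : Measurable fun z =>
      pdfZ 𝒳 𝒴 f z * (∑ u, probUgivenZ 𝒳 q w u z ^ α) ^ (β / α) :=
    (measurable_pdfZ hf).mul ((Finset.measurable_sum _ fun u _ =>
      (measurable_probUgivenZ hq.measurable (hw.measurable u)).pow_const α).pow_const _)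
  refine ENNReal.div_le_of_le_mul ?_
  rw [gainYZ_eq hα (by linarith) hf hq.measurable hw, gainZ_eq hα (by linarith) hq.measurable hw,
    ← lintegral_const_mul _ hm]
  refine lintegral_mono_ae ?_
  filter_upwards [ae_lt_top (measurable_pdfZ hf) hZ, ae_restrict_mem h𝒵] with z hz hz𝒵
  by_cases h0 : pdfZ 𝒳 𝒴 f z = 0
  · simp [h0]
  have hzs : z ∈ suppZ 𝒳 𝒴 𝒵 f := ⟨hz𝒵, pos_iff_ne_zero.2 h0, hz⟩
  rw [mul_left_comm]
  gcongr
  exact lintegral_gain_le hf hα hβ hw hzs (hq.isPDFOn z hzs) (hC z hzs)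

end UpperBound

/-! ### Densities concentrating at points of the support -/

section Localization

open Filter Topology

variable {𝒳 𝒴 𝒵 : Set ℝ} {f : ℝ × ℝ × ℝ → ℝ}

/-- The marginal density `f_{XZ}` is lower semicontinuous by Fatou's lemma, hence positive near
every point where it is positive. -/
theorem eventually_pdfXZ_pos (h𝒴 : MeasurableSet 𝒴) (hfm : Measurable f)
    (hf : ContinuousOn f (𝒳 ×ˢ 𝒴 ×ˢ 𝒵)) {a c : ℝ} (ha : a ∈ 𝒳) (hc : c ∈ 𝒵)
    (hpos : 0 < pdfXZ 𝒴 f a c) :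
    ∀ᶠ p in 𝓝[𝒳 ×ˢ 𝒵] (a, c), 0 < pdfXZ 𝒴 f p.1 p.2 := by
  have : (𝓝[𝒳 ×ˢ 𝒵] (a, c)).NeBot := mem_closure_iff_nhdsWithin_neBot.1 (subset_closure ⟨ha, hc⟩)
  refine eventually_lt_of_lt_liminf (hpos.trans_le ?_)
  refine le_trans (le_of_eq ?_) (lintegral_liminf_le (u := 𝓝[𝒳 ×ˢ 𝒵] (a, c))
    (f := fun p y => ENNReal.ofReal (f (p.1, y, p.2)))
    (fun p => ENNReal.measurable_ofReal.comp (hfm.comp (by fun_prop))))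
  refine setLIntegral_congr_fun h𝒴 fun y hy => (Tendsto.liminf_eq ?_).symm
  refine (ENNReal.continuous_ofReal.tendsto _).comp ?_
  refine (hf (a, y, c) ⟨ha, hy, hc⟩).tendsto.comp (tendsto_nhdsWithin_iff.2 ⟨?_, ?_⟩)
  · exact ((by fun_prop : Continuous fun p : ℝ × ℝ => (p.1, y, p.2)).tendsto (a, c)).mono_left
      nhdsWithin_le_nhds
  · filter_upwards [self_mem_nhdsWithin] with p hp
    exact ⟨hp.1, hy, hp.2⟩

theorem volume_inter_ball_pos {S : Set ℝ} (hS : S ⊆ closure (interior S)) {a : ℝ} (ha : a ∈ S)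
    {δ : ℝ} (hδ : 0 < δ) : 0 < volume (S ∩ Metric.ball a δ) := by
  have hne : (Metric.ball a δ ∩ interior S).Nonempty :=
    mem_closure_iff.1 (hS ha) _ Metric.isOpen_ball (Metric.mem_ball_self hδ)
  refine ((Metric.isOpen_ball.inter isOpen_interior).measure_pos volume hne).trans_le
    (measure_mono fun x hx => ⟨interior_subset hx.2, hx.1⟩)

theorem eventually_volume_suppX_inter_ball_pos (h𝒳 : MeasurableSet 𝒳) (h𝒴 : MeasurableSet 𝒴)
    (h𝒳' : 𝒳 ⊆ closure (interior 𝒳)) (hfm : Measurable f)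
    (hf : ContinuousOn f (𝒳 ×ˢ 𝒴 ×ˢ 𝒵)) {a c : ℝ} (hc : c ∈ suppZ 𝒳 𝒴 𝒵 f)
    (ha : a ∈ suppX 𝒳 𝒴 f c) {δ : ℝ} (hδ : 0 < δ) :
    ∀ᶠ z in 𝓝[𝒵] c, pdfZ 𝒳 𝒴 f z < ∞ →
      z ∈ suppZ 𝒳 𝒴 𝒵 f ∧ volume (suppX 𝒳 𝒴 f z ∩ Metric.ball a δ) ≠ 0 := by
  have ha' := (mem_suppX_iff hc).1 ha
  have h1 := eventually_pdfXZ_pos h𝒴 hfm hf ha'.1 hc.1 ha'.2.1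
  rw [nhdsWithin_prod_eq, eventually_prod_iff] at h1
  obtain ⟨p, hp, r, hr, hpr⟩ := h1
  obtain ⟨ρ, hρ, hball⟩ := Metric.mem_nhdsWithin_iff.1 hp
  have hvol : 0 < volume (𝒳 ∩ Metric.ball a (min ρ δ)) :=
    volume_inter_ball_pos h𝒳' ha'.1 (lt_min hρ hδ)
  have hmem : ∀ x ∈ 𝒳 ∩ Metric.ball a (min ρ δ), p x := fun x hx =>
    hball ⟨Metric.ball_subset_ball (min_le_left _ _) hx.2, hx.1⟩
  filter_upwards [hr, self_mem_nhdsWithin] with z hrz hz𝒵 hztop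
  have hposx : ∀ x ∈ 𝒳 ∩ Metric.ball a (min ρ δ), 0 < pdfXZ 𝒴 f x z := fun x hx =>
    hpr (hmem x hx) hrz
  have hm : Measurable fun x => pdfXZ 𝒴 f x z :=
    (measurable_pdfXZ hfm).comp (by fun_prop : Measurable fun x : ℝ => (x, z))
  have hzpos : 0 < pdfZ 𝒳 𝒴 f z := by
    refine lt_of_lt_of_le ?_ (lintegral_mono_set (inter_subset_left (t := Metric.ball a (min ρ δ))))
    rw [setLIntegral_pos_iff hm]
    refine hvol.trans_le (measure_mono fun x hx => ⟨(hposx x hx).ne', hx⟩)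
  have hz : z ∈ suppZ 𝒳 𝒴 𝒵 f := ⟨hz𝒵, hzpos, hztop⟩
  refine ⟨hz, (hvol.trans_le (measure_mono_ae ?_)).ne'⟩
  have hae := ae_pdfXZ_lt_top (𝒳 := 𝒳) hfm hztop.ne
  rw [ae_restrict_iff' h𝒳] at hae
  filter_upwards [hae] with x hx hx'
  exact ⟨(mem_suppX_iff hz).2 ⟨hx'.1, hposx x hx', hx hx'.1⟩,
    Metric.ball_subset_ball (min_le_right _ _) hx'.2⟩

/-- Near a point `c` of the support of `Z` there is a set of positive measure of values `z` for
which all of finitely many given points `a i` of the support of `X` given `Z = c` can be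
approximated inside the support of `X` given `Z = z`. -/
theorem exists_measurableSet_suppX_inter_ball {ι : Type*} [Finite ι] [Nonempty ι]
    (h𝒳 : MeasurableSet 𝒳)
    (h𝒴 : MeasurableSet 𝒴) (h𝒵 : MeasurableSet 𝒵) (h𝒳' : 𝒳 ⊆ closure (interior 𝒳))
    (h𝒵' : 𝒵 ⊆ closure (interior 𝒵)) (hfm : Measurable f) (hf : ContinuousOn f (𝒳 ×ˢ 𝒴 ×ˢ 𝒵))
    (hZ : ∫⁻ z in 𝒵, pdfZ 𝒳 𝒴 f z ≠ ∞) {c : ℝ} (hc : c ∈ suppZ 𝒳 𝒴 𝒵 f) {a : ι → ℝ}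
    (ha : ∀ i, a i ∈ suppX 𝒳 𝒴 f c) {δ : ℝ} (hδ : 0 < δ) :
    ∃ A, MeasurableSet A ∧ A ⊆ suppZ 𝒳 𝒴 𝒵 f ∧ A ⊆ Metric.ball c δ ∧ volume A ≠ 0 ∧
      ∀ z ∈ A, ∀ i, volume (suppX 𝒳 𝒴 f z ∩ Metric.ball (a i) δ) ≠ 0 := by
  have h1 : ∀ᶠ z in 𝓝[𝒵] c, ∀ i, pdfZ 𝒳 𝒴 f z < ∞ →
      z ∈ suppZ 𝒳 𝒴 𝒵 f ∧ volume (suppX 𝒳 𝒴 f z ∩ Metric.ball (a i) δ) ≠ 0 :=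
    eventually_all.2 fun i => eventually_volume_suppX_inter_ball_pos h𝒳 h𝒴 h𝒳' hfm hf hc (ha i) hδ
  obtain ⟨ρ, hρ, hball⟩ := Metric.mem_nhdsWithin_iff.1 h1
  refine ⟨(𝒵 ∩ Metric.ball c (min ρ δ)) ∩ {z | pdfZ 𝒳 𝒴 f z < ∞},
    (h𝒵.inter measurableSet_ball).inter (measurableSet_lt (measurable_pdfZ hfm) measurable_const),
    fun z hz => ?_, fun z hz => Metric.ball_subset_ball (min_le_right _ _) hz.1.2, ?_,
    fun z hz i => ?_⟩
  · exact (hball ⟨Metric.ball_subset_ball (min_le_left _ _) hz.1.2, hz.1.1⟩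
      (Classical.arbitrary ι) hz.2).1
  · have hvol : 0 < volume (𝒵 ∩ Metric.ball c (min ρ δ)) :=
      volume_inter_ball_pos h𝒵' hc.1 (lt_min hρ hδ)
    refine (hvol.trans_le (measure_mono_ae ?_)).ne'
    have hae := ae_lt_top (measurable_pdfZ (𝒳 := 𝒳) (𝒴 := 𝒴) hfm) hZ
    rw [ae_restrict_iff' h𝒵] at hae
    filter_upwards [hae] with z hz hz'
    exact ⟨hz', hz hz'.1⟩
  · exact (hball ⟨Metric.ball_subset_ball (min_le_left _ _) hz.1.2, hz.1.1⟩ i hz.2).2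

/-- The uniform density on the part of the support of `X` given `Z = z` within distance `δ` of
`a`. -/
noncomputable def localUniform (𝒳 𝒴 : Set ℝ) (f : ℝ × ℝ × ℝ → ℝ) (a δ x z : ℝ) : ℝ≥0∞ :=
  {p : ℝ × ℝ | p.1 ∈ suppX 𝒳 𝒴 f p.2 ∧ p.1 ∈ Metric.ball a δ}.indicator
    (fun p => (volume (suppX 𝒳 𝒴 f p.2 ∩ Metric.ball a δ))⁻¹) (x, z)

theorem measurable_localUniform (hfm : Measurable f) (h𝒳 : MeasurableSet 𝒳) (a δ : ℝ) :
    Measurable fun p : ℝ × ℝ => localUniform 𝒳 𝒴 f a δ p.1 p.2 := by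
  have hs : MeasurableSet {p : ℝ × ℝ | p.1 ∈ suppX 𝒳 𝒴 f p.2 ∧ p.1 ∈ Metric.ball a δ} :=
    (measurableSet_mem_suppX hfm h𝒳).inter (measurable_fst measurableSet_ball)
  refine Measurable.indicator (Measurable.inv ?_) hs
  exact (measurable_measure_prodMk_right (μ := volume) hs).comp measurable_snd

theorem isPDFOn_localUniform (hfm : Measurable f) (h𝒳 : MeasurableSet 𝒳) {a δ z : ℝ}
    (h : volume (suppX 𝒳 𝒴 f z ∩ Metric.ball a δ) ≠ 0) :
    IsPDFOn (suppX 𝒳 𝒴 f z ∩ Metric.ball a δ) fun x => localUniform 𝒳 𝒴 f a δ x z := by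
  refine ⟨(measurable_localUniform hfm h𝒳 a δ).comp
    (by fun_prop : Measurable fun x : ℝ => (x, z)), fun x hx =>
    indicator_of_notMem (a := ((x, z) : ℝ × ℝ)) hx _, ?_⟩
  have : (fun x => localUniform 𝒳 𝒴 f a δ x z) = (suppX 𝒳 𝒴 f z ∩ Metric.ball a δ).indicator
      fun _ => (volume (suppX 𝒳 𝒴 f z ∩ Metric.ball a δ))⁻¹ := rfl
  rw [this, lintegral_indicator ((measurableSet_suppX hfm h𝒳 z).inter measurableSet_ball),
    setLIntegral_const, ENNReal.inv_mul_cancel h]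
  exact measure_ne_top_of_subset inter_subset_right measure_ball_lt_top.ne

theorem localUniform_ne_top {a δ x z : ℝ}
    (h : volume (suppX 𝒳 𝒴 f z ∩ Metric.ball a δ) ≠ 0) : localUniform 𝒳 𝒴 f a δ x z ≠ ∞ := by
  unfold localUniform
  refine ne_top_of_le_ne_top (ENNReal.inv_ne_top.2 h) (indicator_le_self _ _ (x, z))

theorem IsPDFOn.mono {S T : Set ℝ} {g : ℝ → ℝ≥0∞} (hg : IsPDFOn S g) (hST : S ⊆ T) :
    IsPDFOn T g :=
  ⟨hg.measurable, fun x hx => hg.zero_off x fun h => hx (hST h), hg.lintegral_eq_one⟩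

theorem IsPDFOn.le_lintegral {S : Set ℝ} {g k : ℝ → ℝ≥0∞} (hg : IsPDFOn S g) {c : ℝ≥0∞}
    (h : ∀ x ∈ S, c ≤ k x) : c ≤ ∫⁻ x, g x * k x := by
  calc c = ∫⁻ x, g x * c := by
        rw [lintegral_mul_const _ hg.measurable, hg.lintegral_eq_one, one_mul]
    _ ≤ _ := lintegral_mono fun x => by
      by_cases hx : x ∈ S
      · exact mul_le_mul' le_rfl (h x hx)
      · simp [hg.zero_off x hx]

theorem IsPDFOn.lintegral_le {S : Set ℝ} {g k : ℝ → ℝ≥0∞} (hg : IsPDFOn S g) {c : ℝ≥0∞}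
    (h : ∀ x ∈ S, k x ≤ c) : ∫⁻ x, g x * k x ≤ c := by
  calc ∫⁻ x, g x * k x ≤ ∫⁻ x, g x * c := lintegral_mono fun x => by
        by_cases hx : x ∈ S
        · exact mul_le_mul' le_rfl (h x hx)
        · simp [hg.zero_off x hx]
    _ = c := by rw [lintegral_mul_const _ hg.measurable, hg.lintegral_eq_one, one_mul]

/-- Averages over densities that concentrate at `a`, with a drifting parameter `z k → c`, converge
to the value at `(a, c)` of a function that is continuous within a set `D` there. -/
theorem tendsto_lintegral_of_concentrating {D : Set (ℝ × ℝ)} {φ : ℝ × ℝ → ℝ≥0∞} {a c : ℝ}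
    (hφ : ContinuousWithinAt φ D (a, c)) {δ : ℕ → ℝ} (hδ : Tendsto δ atTop (𝓝 0)) {z : ℕ → ℝ}
    (hz : ∀ k, dist (z k) c < δ k) {S : ℕ → Set ℝ} {g : ℕ → ℝ → ℝ≥0∞}
    (hg : ∀ k, IsPDFOn (S k) (g k)) (hS : ∀ k, ∀ x ∈ S k, (x, z k) ∈ D ∧ dist x a < δ k) :
    Tendsto (fun k => ∫⁻ x, g k x * φ (x, z k)) atTop (𝓝 (φ (a, c))) := by
  have key : ∀ P : ℝ≥0∞ → Prop, (∀ᶠ t in 𝓝 (φ (a, c)), P t) →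
      ∀ᶠ k in atTop, ∀ x ∈ S k, P (φ (x, z k)) := by
    intro P hP
    obtain ⟨r, hr, hball⟩ := Metric.mem_nhdsWithin_iff.1 (hφ hP)
    filter_upwards [hδ.eventually_lt_const hr] with k hk x hx
    refine hball ⟨?_, (hS k x hx).1⟩
    rw [Metric.mem_ball, Prod.dist_eq, max_lt_iff]
    exact ⟨(hS k x hx).2.trans hk, (hz k).trans hk⟩
  refine tendsto_order.2 ⟨fun b hb => ?_, fun b hb => ?_⟩
  · obtain ⟨b', h1, h2⟩ := exists_between hb
    filter_upwards [key _ (eventually_ge_nhds h2)] with k hk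
    exact h1.trans_le ((hg k).le_lintegral hk)
  · obtain ⟨b', h1, h2⟩ := exists_between hb
    filter_upwards [key _ (eventually_le_nhds h1)] with k hk
    exact ((hg k).lintegral_le hk).trans_lt h2

end Localization

/-! ### The test input and the test variable -/

section Construction

open Filter Topology

variable {𝒳 𝒴 𝒵 : Set ℝ} {f : ℝ × ℝ × ℝ → ℝ} {α β : ℝ}

/-- A unit mass shared out evenly among `M` symbols contributes nothing to `∑ᵤ pᵤ ^ α` in the
limit. -/
theorem tendsto_natCast_mul_inv_rpow (hα : 1 < α) :
    Tendsto (fun M : ℕ => (M : ℝ≥0∞) * (M : ℝ≥0∞)⁻¹ ^ α) atTop (𝓝 0) := by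
  have h1 : Tendsto (fun M : ℕ => ((M : ℝ≥0∞) ^ (α - 1))⁻¹) atTop (𝓝 0) := by
    rw [← ENNReal.inv_top]
    refine tendsto_inv_iff.2 ?_
    exact (ENNReal.tendsto_rpow_at_top (by linarith)).comp ENNReal.tendsto_nat_nhds_top
  refine h1.congr' ?_
  filter_upwards [eventually_ge_atTop 1] with M hM
  have hM0 : (M : ℝ≥0∞) ≠ 0 := by
    rw [Nat.cast_ne_zero]; omega
  rw [ENNReal.inv_rpow, ← ENNReal.rpow_neg, ← ENNReal.rpow_neg]
  conv_rhs => enter [1]; rw [← ENNReal.rpow_one (M : ℝ≥0∞)]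
  rw [← ENNReal.rpow_add _ _ hM0 (ENNReal.natCast_ne_top M)]
  congr 1
  ring

/-- The true conditional density of `X` given `Z` is admissible. -/
theorem isCondPDF_pdfXgivenZ (h𝒳 : MeasurableSet 𝒳) (hfm : Measurable f) :
    IsCondPDF 𝒳 𝒴 𝒵 f fun x z =>
      {p : ℝ × ℝ | p.1 ∈ suppX 𝒳 𝒴 f p.2}.indicator
        (fun p => pdfXgivenZ 𝒳 𝒴 f p.1 p.2) (x, z) := by
  have hm := (measurable_pdfXgivenZ (𝒳 := 𝒳) (𝒴 := 𝒴) hfm).indicator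
    (measurableSet_mem_suppX (𝒴 := 𝒴) hfm h𝒳)
  refine ⟨hm, fun z hz => ⟨hm.comp (by fun_prop : Measurable fun x : ℝ => (x, z)),
    fun x hx => indicator_of_notMem (a := ((x, z) : ℝ × ℝ)) hx _, ?_⟩⟩
  have hsm : Measurable fun x => pdfXZ 𝒴 f x z :=
    (measurable_pdfXZ hfm).comp (by fun_prop : Measurable fun x : ℝ => (x, z))
  calc ∫⁻ x, {p : ℝ × ℝ | p.1 ∈ suppX 𝒳 𝒴 f p.2}.indicator
        (fun p => pdfXgivenZ 𝒳 𝒴 f p.1 p.2) (x, z)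
      = ∫⁻ x, 𝒳.indicator (fun x => pdfXgivenZ 𝒳 𝒴 f x z) x := by
        refine lintegral_congr_ae ?_
        have hae := ae_pdfXZ_lt_top (𝒳 := 𝒳) hfm hz.2.2.ne
        rw [ae_restrict_iff' h𝒳] at hae
        filter_upwards [hae] with x hx
        by_cases hx𝒳 : x ∈ 𝒳
        · rw [indicator_of_mem hx𝒳]
          by_cases h0 : 0 < pdfXZ 𝒴 f x z
          · exact indicator_of_mem (a := ((x, z) : ℝ × ℝ))
              ((mem_suppX_iff hz).2 ⟨hx𝒳, h0, hx hx𝒳⟩) _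
          · rw [indicator_of_notMem (a := ((x, z) : ℝ × ℝ))
              fun h => h0 ((mem_suppX_iff hz).1 h).2.1, pdfXgivenZ,
              nonpos_iff_eq_zero.1 (not_lt.1 h0),
              ENNReal.zero_div]
        · rw [indicator_of_notMem hx𝒳, indicator_of_notMem (a := ((x, z) : ℝ × ℝ))
            fun h => hx𝒳 ((mem_suppX_iff hz).1 h).1]
    _ = pdfZ 𝒳 𝒴 f z / pdfZ 𝒳 𝒴 f z := by
        rw [lintegral_indicator h𝒳]
        simp only [pdfXgivenZ, div_eq_mul_inv]
        rw [lintegral_mul_const _ hsm]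
        rfl
    _ = 1 := ENNReal.div_self hz.2.1.ne' hz.2.2.ne

variable {A : Set ℝ} {r : ℝ → ℝ → ℝ≥0∞} {n : ℕ} {d : Fin n → ℝ → ℝ → ℝ≥0∞} {b : Fin n → ℝ≥0∞}
  {ε : ℝ≥0∞}

/-- The mixture of the densities `r` and `d i` with weights `1 - ε` and `ε * b i`. -/
noncomputable def mixture (r : ℝ → ℝ → ℝ≥0∞) (d : Fin n → ℝ → ℝ → ℝ≥0∞) (b : Fin n → ℝ≥0∞)
    (ε : ℝ≥0∞) (x z : ℝ) : ℝ≥0∞ :=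
  (1 - ε) * r x z + ∑ i, ε * b i * d i x z

open Classical in
/-- The input density used for the lower bound: a mixture for `z ∈ A`, and the true conditional
density of `X` elsewhere. -/
noncomputable def testDensity (𝒳 𝒴 : Set ℝ) (f : ℝ × ℝ × ℝ → ℝ) (A : Set ℝ)
    (r : ℝ → ℝ → ℝ≥0∞) (d : Fin n → ℝ → ℝ → ℝ≥0∞) (b : Fin n → ℝ≥0∞)
    (ε : ℝ≥0∞) (x z : ℝ) : ℝ≥0∞ :=
  if z ∈ A then mixture r d b ε x z else
    {p : ℝ × ℝ | p.1 ∈ suppX 𝒳 𝒴 f p.2}.indicator (fun p => pdfXgivenZ 𝒳 𝒴 f p.1 p.2) (x, z)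

open Classical in
/-- The variable `U` used for the lower bound, with alphabet `Fin (M + n)`. For `z ∈ A` the input
density is a mixture, and `U` tells which component `X` was drawn from: the last `n` symbols stand
for the densities `d i`, while the component `r` is shared out evenly among the first `M` symbols.
Elsewhere `U` is uniform and independent of `X`. -/
noncomputable def testKernel (A : Set ℝ) (r : ℝ → ℝ → ℝ≥0∞) (d : Fin n → ℝ → ℝ → ℝ≥0∞)
    (b : Fin n → ℝ≥0∞) (ε : ℝ≥0∞) (M : ℕ) (u : Fin (M + n)) (p : ℝ × ℝ) : ℝ≥0∞ :=
  if p.2 ∈ A ∧ mixture r d b ε p.1 p.2 ≠ 0 ∧ mixture r d b ε p.1 p.2 ≠ ∞ then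
    Fin.addCases (motive := fun _ => ℝ≥0∞)
      (fun _ => (1 - ε) * (M : ℝ≥0∞)⁻¹ * r p.1 p.2) (fun i => ε * b i * d i p.1 p.2) u /
        mixture r d b ε p.1 p.2
  else ((M + n : ℕ) : ℝ≥0∞)⁻¹

theorem measurable_mixture (hr : Measurable fun p : ℝ × ℝ => r p.1 p.2)
    (hd : ∀ i, Measurable fun p : ℝ × ℝ => d i p.1 p.2) :
    Measurable fun p : ℝ × ℝ => mixture r d b ε p.1 p.2 :=
  (hr.const_mul _).add (Finset.measurable_sum _ fun i _ => (hd i).const_mul _)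

theorem isCondPMF_testKernel (hA : MeasurableSet A) (hr : Measurable fun p : ℝ × ℝ => r p.1 p.2)
    (hd : ∀ i, Measurable fun p : ℝ × ℝ => d i p.1 p.2) {M : ℕ} (hM : M ≠ 0) :
    IsCondPMF (testKernel A r d b ε M) := by
  have hmix := measurable_mixture (b := b) (ε := ε) hr hd
  refine ⟨fun u => ?_, fun p => ?_⟩
  · refine Measurable.ite ?_ (Measurable.div ?_ hmix) measurable_const
    · exact (measurable_snd hA).inter ((hmix (measurableSet_singleton 0).compl).inter
        (hmix (measurableSet_singleton ∞).compl))
    · induction u using Fin.addCases with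
      | left j => simpa using hr.const_mul _
      | right i => simpa using (hd i).const_mul _
  · unfold testKernel
    split_ifs with h
    · simp only [div_eq_mul_inv]
      rw [← Finset.sum_mul, Fin.sum_univ_add]
      simp only [Fin.addCases_left, Fin.addCases_right, Finset.sum_const, Finset.card_univ,
        Fintype.card_fin, nsmul_eq_mul]
      have hM0 : (M : ℝ≥0∞) ≠ 0 := Nat.cast_ne_zero.2 hM
      rw [mul_assoc (1 - ε), mul_left_comm, ← mul_assoc (M : ℝ≥0∞),
        ENNReal.mul_inv_cancel hM0 (ENNReal.natCast_ne_top M), one_mul]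
      exact ENNReal.mul_inv_cancel h.2.1 h.2.2
    · rw [Finset.sum_const, Finset.card_univ, Fintype.card_fin, nsmul_eq_mul]
      refine ENNReal.mul_inv_cancel (Nat.cast_ne_zero.2 (by omega)) (ENNReal.natCast_ne_top _)

theorem isPDFOn_mixture {S : Set ℝ} {z : ℝ} (hr : IsPDFOn S fun x => r x z)
    (hd : ∀ i, IsPDFOn S fun x => d i x z) (hb : ∑ i, b i = 1) (hε : ε ≤ 1) :
    IsPDFOn S fun x => mixture r d b ε x z := by
  refine ⟨(hr.measurable.const_mul _).add
    (Finset.measurable_sum _ fun i _ => (hd i).measurable.const_mul _), fun x hx => ?_, ?_⟩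
  · have : ∀ i, d i x z = 0 := fun i => (hd i).zero_off x hx
    simp [mixture, this, hr.zero_off x hx]
  · unfold mixture
    rw [lintegral_add_left (hr.measurable.const_mul _), lintegral_const_mul _ hr.measurable,
      hr.lintegral_eq_one, lintegral_finsetSum _ fun i _ => (hd i).measurable.const_mul _]
    have : ∀ i, ∫⁻ x, ε * b i * d i x z = ε * b i := fun i => by
      rw [lintegral_const_mul _ (hd i).measurable, (hd i).lintegral_eq_one, mul_one]
    simp only [this]
    rw [← Finset.mul_sum, hb, mul_one, mul_one, tsub_add_cancel_of_le hε]

theorem isCondPDF_testDensity (h𝒳 : MeasurableSet 𝒳) (hfm : Measurable f) (hA : MeasurableSet A)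
    (hr : Measurable fun p : ℝ × ℝ => r p.1 p.2)
    (hd : ∀ i, Measurable fun p : ℝ × ℝ => d i p.1 p.2)
    (hrA : ∀ z ∈ A, IsPDFOn (suppX 𝒳 𝒴 f z) fun x => r x z)
    (hdA : ∀ z ∈ A, ∀ i, IsPDFOn (suppX 𝒳 𝒴 f z) fun x => d i x z)
    (hb : ∑ i, b i = 1) (hε : ε ≤ 1) :
    IsCondPDF 𝒳 𝒴 𝒵 f (testDensity 𝒳 𝒴 f A r d b ε) := by
  refine ⟨Measurable.ite (measurable_snd hA) (measurable_mixture hr hd)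
    (isCondPDF_pdfXgivenZ (𝒵 := 𝒵) h𝒳 hfm).measurable, fun z hz => ?_⟩
  by_cases hzA : z ∈ A
  · simpa only [testDensity, if_pos hzA] using isPDFOn_mixture (hrA z hzA) (hdA z hzA) hb hε
  · simpa only [testDensity, if_neg hzA] using (isCondPDF_pdfXgivenZ h𝒳 hfm).isPDFOn z hz

theorem mixture_ne_top {x z : ℝ} (hr : r x z ≠ ∞) (hd : ∀ i, d i x z ≠ ∞) (hb : ∑ i, b i = 1)
    (hε : ε ≤ 1) : mixture r d b ε x z ≠ ∞ := by
  have hε' : ε ≠ ∞ := ne_top_of_le_ne_top ENNReal.one_ne_top hε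
  have hb' : ∀ i, b i ≠ ∞ := fun i => by
    have := ENNReal.sum_ne_top.1 (hb ▸ ENNReal.one_ne_top : ∑ i, b i ≠ ∞)
    exact this i (Finset.mem_univ i)
  refine ENNReal.add_ne_top.2 ⟨ENNReal.mul_ne_top (by simp) hr, ENNReal.sum_ne_top.2 fun i _ => ?_⟩
  exact ENNReal.mul_ne_top (ENNReal.mul_ne_top hε' (hb' i)) (hd i)

/-- The joint density of `X` and `U` given `Z = z ∈ A`. -/
theorem testDensity_mul_testKernel {z : ℝ} (hz : z ∈ A) (hr : ∀ x, r x z ≠ ∞)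
    (hd : ∀ i x, d i x z ≠ ∞) (hb : ∑ i, b i = 1) (hε : ε ≤ 1) {M : ℕ} (x : ℝ) (u : Fin (M + n)) :
    testDensity 𝒳 𝒴 f A r d b ε x z * testKernel A r d b ε M u (x, z) =
      Fin.addCases (motive := fun _ => ℝ≥0∞) (fun _ => (1 - ε) * (M : ℝ≥0∞)⁻¹ * r x z)
        (fun i => ε * b i * d i x z) u := by
  have htop : mixture r d b ε x z ≠ ∞ := mixture_ne_top (hr x) (fun i => hd i x) hb hε
  rw [testDensity, if_pos hz, testKernel]
  by_cases h0 : mixture r d b ε x z = 0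
  · rw [h0, zero_mul]
    rw [mixture, add_eq_zero, Finset.sum_eq_zero_iff] at h0
    induction u using Fin.addCases with
    | left j =>
      rw [Fin.addCases_left, mul_right_comm, h0.1, zero_mul]
    | right i => rw [Fin.addCases_right, h0.2 i (Finset.mem_univ i)]
  · rw [if_pos ⟨hz, h0, htop⟩, ENNReal.mul_div_cancel h0 htop]

end Construction

/-! ### Gains of the test variable -/

section TestGains

open Filter Topology

variable {𝒳 𝒴 𝒵 : Set ℝ} {f : ℝ × ℝ × ℝ → ℝ} {α β : ℝ}
  {A : Set ℝ} {r : ℝ → ℝ → ℝ≥0∞} {n : ℕ} {d : Fin n → ℝ → ℝ → ℝ≥0∞} {b : Fin n → ℝ≥0∞}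
  {ε : ℝ≥0∞}

theorem setLIntegral_const_mul_of_isPDFOn {S : Set ℝ} (hS : S ⊆ 𝒳) {g : ℝ → ℝ≥0∞}
    (hg : IsPDFOn S g) (c : ℝ≥0∞) : ∫⁻ x in 𝒳, c * g x = c := by
  simp only [mul_comm c]
  rw [hg.setLIntegral_eq hS fun _ => c, lintegral_mul_const _ hg.measurable, hg.lintegral_eq_one,
    one_mul]

theorem probUgivenZ_test_natAdd {z : ℝ} (hz : z ∈ A) (hr : ∀ x, r x z ≠ ∞)
    (hd : ∀ i x, d i x z ≠ ∞) (hb : ∑ i, b i = 1) (hε : ε ≤ 1)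
    (hdA : ∀ i, IsPDFOn (suppX 𝒳 𝒴 f z) fun x => d i x z) (M : ℕ) (i : Fin n) :
    probUgivenZ 𝒳 (testDensity 𝒳 𝒴 f A r d b ε) (testKernel A r d b ε M) (Fin.natAdd M i) z =
      ε * b i := by
  simp only [probUgivenZ, testDensity_mul_testKernel hz hr hd hb hε, Fin.addCases_right]
  exact setLIntegral_const_mul_of_isPDFOn (suppX_subset z) (hdA i) _

theorem probUgivenZ_test_castAdd {z : ℝ} (hz : z ∈ A) (hr : ∀ x, r x z ≠ ∞)
    (hd : ∀ i x, d i x z ≠ ∞) (hb : ∑ i, b i = 1) (hε : ε ≤ 1)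
    (hrA : IsPDFOn (suppX 𝒳 𝒴 f z) fun x => r x z) (M : ℕ) (j : Fin M) :
    probUgivenZ 𝒳 (testDensity 𝒳 𝒴 f A r d b ε) (testKernel A r d b ε M) (Fin.castAdd n j) z =
      (1 - ε) * (M : ℝ≥0∞)⁻¹ := by
  simp only [probUgivenZ, testDensity_mul_testKernel hz hr hd hb hε, Fin.addCases_left]
  exact setLIntegral_const_mul_of_isPDFOn (suppX_subset z) hrA _

theorem probUgivenZ_testKernel_of_notMem {q : ℝ → ℝ → ℝ≥0∞} {S : Set ℝ} (hS : S ⊆ 𝒳) {z : ℝ}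
    (hz : z ∉ A) (hq : IsPDFOn S fun x => q x z) (M : ℕ) (u : Fin (M + n)) :
    probUgivenZ 𝒳 q (testKernel A r d b ε M) u z = ((M + n : ℕ) : ℝ≥0∞)⁻¹ := by
  have : ∀ x, testKernel A r d b ε M u (x, z) = ((M + n : ℕ) : ℝ≥0∞)⁻¹ := fun x =>
    if_neg fun h => hz h.1
  simp only [probUgivenZ, this]
  simp only [mul_comm (q _ z)]
  exact setLIntegral_const_mul_of_isPDFOn hS hq _

/-- The part of the gain that comes from the component `r` and from `z ∉ A` is at most of the order
of a power of `M * (1 / M) ^ α`. -/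
theorem gainZ_test_le (hα : 1 < α) (hβ : 1 ≤ β) (h𝒳 : MeasurableSet 𝒳) (h𝒵 : MeasurableSet 𝒵)
    (hfm : Measurable f) (hZ : ∫⁻ z in 𝒵, pdfZ 𝒳 𝒴 f z = 1)
    (hA : MeasurableSet A) (hA𝒵 : A ⊆ suppZ 𝒳 𝒴 𝒵 f)
    (hr : Measurable fun p : ℝ × ℝ => r p.1 p.2)
    (hd : ∀ i, Measurable fun p : ℝ × ℝ => d i p.1 p.2)
    (hrA : ∀ z ∈ A, IsPDFOn (suppX 𝒳 𝒴 f z) fun x => r x z)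
    (hdA : ∀ z ∈ A, ∀ i, IsPDFOn (suppX 𝒳 𝒴 f z) fun x => d i x z)
    (hrt : ∀ z ∈ A, ∀ x, r x z ≠ ∞) (hdt : ∀ z ∈ A, ∀ i x, d i x z ≠ ∞)
    (hb : ∑ i, b i = 1) (hε : ε ≤ 1) {M : ℕ} (hM : M ≠ 0) :
    gainZ α β 𝒳 𝒴 𝒵 f (testDensity 𝒳 𝒴 f A r d b ε) (testKernel A r d b ε M) ≤
      ((M : ℝ≥0∞) * (M : ℝ≥0∞)⁻¹ ^ α + ∑ i, (ε * b i) ^ α) ^ (β / α) *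
          (∫⁻ z in A, pdfZ 𝒳 𝒴 f z) +
        (((M + n : ℕ) : ℝ≥0∞) * ((M + n : ℕ) : ℝ≥0∞)⁻¹ ^ α) ^ (β / α) := by
  have hα0 : 0 < α := by linarith
  have hβα : 0 ≤ β / α := by apply div_nonneg <;> linarith
  have hq := isCondPDF_testDensity (𝒵 := 𝒵) h𝒳 hfm hA hr hd hrA hdA hb hε
  rw [gainZ_eq hα (by linarith) hq.measurable (isCondPMF_testKernel hA hr hd hM)]
  set cA : ℝ≥0∞ := ((M : ℝ≥0∞) * (M : ℝ≥0∞)⁻¹ ^ α + ∑ i, (ε * b i) ^ α) ^ (β / α)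
  set c : ℝ≥0∞ := (((M + n : ℕ) : ℝ≥0∞) * ((M + n : ℕ) : ℝ≥0∞)⁻¹ ^ α) ^ (β / α)
  have hA𝒵' : A ⊆ 𝒵 := fun z hz => (hA𝒵 hz).1
  have hpm := measurable_pdfZ (𝒳 := 𝒳) (𝒴 := 𝒴) hfm
  calc ∫⁻ z in 𝒵, pdfZ 𝒳 𝒴 f z * (∑ u, probUgivenZ 𝒳 (testDensity 𝒳 𝒴 f A r d b ε)
          (testKernel A r d b ε M) u z ^ α) ^ (β / α)
      ≤ ∫⁻ z in 𝒵, (A.indicator (fun z => cA * pdfZ 𝒳 𝒴 f z) z + c * pdfZ 𝒳 𝒴 f z) := by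
        refine lintegral_mono_ae ?_
        have hfin := ae_lt_top hpm (hZ ▸ ENNReal.one_ne_top : ∫⁻ z in 𝒵, pdfZ 𝒳 𝒴 f z ≠ ∞)
        filter_upwards [hfin, ae_restrict_mem h𝒵] with z hzt hz𝒵
        by_cases hzA : z ∈ A
        · rw [indicator_of_mem hzA, mul_comm]
          refine le_add_right (mul_le_mul' (ENNReal.rpow_le_rpow ?_ hβα) le_rfl)
          rw [Fin.sum_univ_add]
          simp only [probUgivenZ_test_natAdd hzA (hrt z hzA) (hdt z hzA) hb hε (hdA z hzA),
            probUgivenZ_test_castAdd hzA (hrt z hzA) (hdt z hzA) hb hε (hrA z hzA)]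
          rw [Finset.sum_const, Finset.card_univ, Fintype.card_fin, nsmul_eq_mul]
          gcongr
          exact mul_le_of_le_one_left' tsub_le_self
        · rw [indicator_of_notMem hzA, zero_add, mul_comm]
          by_cases h0 : pdfZ 𝒳 𝒴 f z = 0
          · simp [h0]
          have hzs : z ∈ suppZ 𝒳 𝒴 𝒵 f := ⟨hz𝒵, pos_iff_ne_zero.2 h0, hzt⟩
          simp only [probUgivenZ_testKernel_of_notMem (suppX_subset z) hzA (hq.isPDFOn z hzs)]
          rw [Finset.sum_const, Finset.card_univ, Fintype.card_fin, nsmul_eq_mul]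
    _ = cA * (∫⁻ z in A, pdfZ 𝒳 𝒴 f z) + c := by
        rw [lintegral_add_right _ (hpm.const_mul c), lintegral_const_mul _ hpm, hZ, mul_one,
          setLIntegral_indicator hA, inter_eq_left.2 hA𝒵', lintegral_const_mul _ hpm]

/-- The output density under the test input is the same mixture of the output densities of the
components. -/
theorem mixYgivenZ_testDensity (hfm : Measurable f) {z : ℝ} (hz : z ∈ A)
    (hr : Measurable fun x => r x z) (hd : ∀ i, Measurable fun x => d i x z) (y : ℝ) :
    mixYgivenZ 𝒳 𝒴 f (testDensity 𝒳 𝒴 f A r d b ε) y z =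
      mixture (mixYgivenZ 𝒳 𝒴 f r) (fun i => mixYgivenZ 𝒳 𝒴 f (d i)) b ε y z := by
  have hKm : Measurable fun x => pdfYgivenXZ 𝒴 f y x z :=
    (measurable_pdfYgivenXZ hfm).comp (by fun_prop : Measurable fun x : ℝ => (y, x, z))
  have hrK : Measurable fun x => r x z * pdfYgivenXZ 𝒴 f y x z := hr.mul hKm
  have hdK : ∀ i, Measurable fun x => d i x z * pdfYgivenXZ 𝒴 f y x z := fun i => (hd i).mul hKm
  simp only [mixYgivenZ, testDensity, if_pos hz, mixture, add_mul, Finset.sum_mul, mul_assoc]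
  rw [lintegral_add_left (hrK.const_mul _), lintegral_const_mul _ hrK,
    lintegral_finsetSum _ fun i _ => ((hdK i).const_mul _).const_mul _]
  simp only [lintegral_const_mul _ ((hdK _).const_mul _), lintegral_const_mul _ (hdK _)]

/-- Only the last `n` symbols and the values `z ∈ A` are kept in the gain from `(Z, Y)`. -/
theorem le_gainYZ_test (hα : 1 < α) (hβ : 1 ≤ β) (h𝒳 : MeasurableSet 𝒳)
    (hfm : Measurable f)
    (hA : MeasurableSet A) (hA𝒵 : A ⊆ suppZ 𝒳 𝒴 𝒵 f)
    (hr : Measurable fun p : ℝ × ℝ => r p.1 p.2)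
    (hd : ∀ i, Measurable fun p : ℝ × ℝ => d i p.1 p.2)
    (hrA : ∀ z ∈ A, IsPDFOn (suppX 𝒳 𝒴 f z) fun x => r x z)
    (hdA : ∀ z ∈ A, ∀ i, IsPDFOn (suppX 𝒳 𝒴 f z) fun x => d i x z)
    (hrt : ∀ z ∈ A, ∀ x, r x z ≠ ∞) (hdt : ∀ z ∈ A, ∀ i x, d i x z ≠ ∞)
    (hb : ∑ i, b i = 1) (hε : ε ≤ 1) {M : ℕ} (hM : M ≠ 0) :
    ε ^ β * ∫⁻ z in A, pdfZ 𝒳 𝒴 f z * ∫⁻ y in 𝒴,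
        mixture (mixYgivenZ 𝒳 𝒴 f r) (fun i => mixYgivenZ 𝒳 𝒴 f (d i)) b ε y z ^ (1 - β) *
          (∑ i, (b i * mixYgivenZ 𝒳 𝒴 f (d i) y z) ^ α) ^ (β / α) ≤
      gainYZ α β 𝒳 𝒴 𝒵 f (testDensity 𝒳 𝒴 f A r d b ε) (testKernel A r d b ε M) := by
  have hα0 : 0 < α := by linarith
  have hβα : 0 < β / α := by apply div_pos <;> linarith
  have hεt : ε ≠ ∞ := ne_top_of_le_ne_top ENNReal.one_ne_top hε
  have hεβ : ε ^ β ≠ ∞ := ENNReal.rpow_ne_top_of_nonneg (by linarith) hεt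
  have hq := isCondPDF_testDensity (𝒵 := 𝒵) h𝒳 hfm hA hr hd hrA hdA hb hε
  have hmq := measurable_mixYgivenZ (𝒳 := 𝒳) (𝒴 := 𝒴) hfm hq.measurable
  rw [gainYZ_eq hα (by linarith) hfm hq.measurable (isCondPMF_testKernel hA hr hd hM),
    ← lintegral_const_mul' _ _ hεβ]
  refine le_trans ?_ (lintegral_mono_set fun z hz => (hA𝒵 hz).1)
  refine setLIntegral_mono_ae' hA (Eventually.of_forall fun z hz => ?_)
  rw [mul_left_comm, ← lintegral_const_mul' _ _ hεβ]
  refine mul_le_mul' le_rfl (lintegral_mono_ae ?_)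
  have hfin : ∀ᵐ y ∂volume.restrict 𝒴,
      mixYgivenZ 𝒳 𝒴 f (testDensity 𝒳 𝒴 f A r d b ε) y z < ∞ := by
    refine ae_lt_top (hmq.comp (by fun_prop : Measurable fun y : ℝ => (y, z))) ?_
    have := lintegral_mixture hfm (hA𝒵 hz) (hq.isPDFOn z (hA𝒵 hz))
    rw [show ∫⁻ y in 𝒴, mixYgivenZ 𝒳 𝒴 f (testDensity 𝒳 𝒴 f A r d b ε) y z = 1 from this]
    exact ENNReal.one_ne_top
  filter_upwards [hfin] with y hy
  have hmix := mixYgivenZ_testDensity (𝒳 := 𝒳) (𝒴 := 𝒴) (b := b) (ε := ε) hfm hz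
    (hr.comp (by fun_prop : Measurable fun x : ℝ => (x, z)))
    (fun i => (hd i).comp (by fun_prop : Measurable fun x : ℝ => (x, z))) y
  rw [← hmix]
  set m := mixYgivenZ 𝒳 𝒴 f (testDensity 𝒳 𝒴 f A r d b ε) y z with hm
  have hN : ∀ i, ∫⁻ x in 𝒳, testDensity 𝒳 𝒴 f A r d b ε x z *
      testKernel A r d b ε M (Fin.natAdd M i) (x, z) * pdfYgivenXZ 𝒴 f y x z =
      ε * b i * mixYgivenZ 𝒳 𝒴 f (d i) y z := fun i => by
    have hdK : Measurable fun x => d i x z * pdfYgivenXZ 𝒴 f y x z :=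
      ((hd i).comp (by fun_prop : Measurable fun x : ℝ => (x, z))).mul
        ((measurable_pdfYgivenXZ hfm).comp (by fun_prop : Measurable fun x : ℝ => (y, x, z)))
    simp only [testDensity_mul_testKernel hz (hrt z hz) (hdt z hz) hb hε, Fin.addCases_right,
      mul_assoc (ε * b i)]
    rw [lintegral_const_mul _ hdK]
    rfl
  have hscale : ε ^ β * (∑ i, (b i * mixYgivenZ 𝒳 𝒴 f (d i) y z) ^ α) ^ (β / α) =
      (∑ i, (ε * b i * mixYgivenZ 𝒳 𝒴 f (d i) y z) ^ α) ^ (β / α) := by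
    simp only [mul_assoc ε, ENNReal.mul_rpow_of_nonneg ε _ hα0.le]
    rw [← Finset.mul_sum, ENNReal.mul_rpow_of_nonneg _ _ hβα.le, ← ENNReal.rpow_mul,
      mul_div_cancel₀ _ hα0.ne']
  rw [mul_left_comm, hscale]
  by_cases hm0 : m = 0
  · -- where the output density vanishes, so do all its components
    have h0 : ∀ i, ε * b i * mixYgivenZ 𝒳 𝒴 f (d i) y z = 0 := fun i => by
      rw [hmix, mixture, add_eq_zero, Finset.sum_eq_zero_iff] at hm0
      exact hm0.2 i (Finset.mem_univ i)
    simp [h0, hα0, hβα]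
  · rw [← mul_sum_div_rpow hα hβ hm0 hy.ne]
    gcongr
    rw [Fin.sum_univ_add]
    simp only [probUgivenYZ, hN]
    exact le_add_self

/-- If all leakage ratios are at most `L`, the test density and the test variable, in the limit
`M → ∞`, yield an inequality in which neither the component `r` nor the values of `Z` outside `A`
contribute to the denominator. -/
theorem exists_mem_lintegral_le (hα : 1 < α) (hβ : 1 ≤ β) (h𝒳 : MeasurableSet 𝒳)
    (h𝒵 : MeasurableSet 𝒵) (hfm : Measurable f) (hZ : ∫⁻ z in 𝒵, pdfZ 𝒳 𝒴 f z = 1)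
    {L : ℝ≥0∞} (hLt : L ≠ ∞)
    (hL : ∀ q, IsCondPDF 𝒳 𝒴 𝒵 f q → ∀ (m : ℕ) (w : Fin m → ℝ × ℝ → ℝ≥0∞), IsCondPMF w →
      gainYZ α β 𝒳 𝒴 𝒵 f q w / gainZ α β 𝒳 𝒴 𝒵 f q w ≤ L)
    (hA : MeasurableSet A) (hA𝒵 : A ⊆ suppZ 𝒳 𝒴 𝒵 f) (hA0 : volume A ≠ 0)
    (hr : Measurable fun p : ℝ × ℝ => r p.1 p.2)
    (hd : ∀ i, Measurable fun p : ℝ × ℝ => d i p.1 p.2)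
    (hrA : ∀ z ∈ A, IsPDFOn (suppX 𝒳 𝒴 f z) fun x => r x z)
    (hdA : ∀ z ∈ A, ∀ i, IsPDFOn (suppX 𝒳 𝒴 f z) fun x => d i x z)
    (hrt : ∀ z ∈ A, ∀ x, r x z ≠ ∞) (hdt : ∀ z ∈ A, ∀ i x, d i x z ≠ ∞)
    (hb : ∑ i, b i = 1) (hε0 : ε ≠ 0) (hε : ε ≤ 1) :
    ∃ z ∈ A, ∫⁻ y in 𝒴,
        mixture (mixYgivenZ 𝒳 𝒴 f r) (fun i => mixYgivenZ 𝒳 𝒴 f (d i)) b ε y z ^ (1 - β) *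
          (∑ i, (b i * mixYgivenZ 𝒳 𝒴 f (d i) y z) ^ α) ^ (β / α) ≤
      L * (∑ i, b i ^ α) ^ (β / α) := by
  have hα0 : 0 < α := by linarith
  have hβα : 0 < β / α := by apply div_pos <;> linarith
  have hεt : ε ≠ ∞ := ne_top_of_le_ne_top ENNReal.one_ne_top hε
  have hεβt : ε ^ β ≠ ∞ := ENNReal.rpow_ne_top_of_nonneg (by linarith) hεt
  have hεβ0 : ε ^ β ≠ 0 := (ENNReal.rpow_pos (pos_iff_ne_zero.2 hε0) hεt).ne'
  have hpm := measurable_pdfZ (𝒳 := 𝒳) (𝒴 := 𝒴) hfm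
  set T : ℝ → ℝ≥0∞ := fun z => ∫⁻ y in 𝒴,
        mixture (mixYgivenZ 𝒳 𝒴 f r) (fun i => mixYgivenZ 𝒳 𝒴 f (d i)) b ε y z ^ (1 - β) *
          (∑ i, (b i * mixYgivenZ 𝒳 𝒴 f (d i) y z) ^ α) ^ (β / α) with hT
  set p : ℝ≥0∞ := ∫⁻ z in A, pdfZ 𝒳 𝒴 f z with hp
  have hp1 : p ≤ 1 := hZ ▸ lintegral_mono_set fun z hz => (hA𝒵 hz).1
  have hpt : p ≠ ∞ := ne_top_of_le_ne_top ENNReal.one_ne_top hp1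
  have hb1 : ∀ i, b i ≤ 1 := fun i => hb ▸
    Finset.single_le_sum (f := b) (fun _ _ => zero_le) (Finset.mem_univ i)
  have hbt : ∑ i, b i ^ α ≠ ∞ := ENNReal.sum_ne_top.2 fun i _ =>
    ENNReal.rpow_ne_top_of_nonneg hα0.le (ne_top_of_le_ne_top ENNReal.one_ne_top (hb1 i))
  have hct : L * (∑ i, b i ^ α) ^ (β / α) ≠ ∞ :=
    ENNReal.mul_ne_top hLt (ENNReal.rpow_ne_top_of_nonneg hβα.le hbt)
  have hTm : Measurable T := by
    have hrm := measurable_mixYgivenZ (𝒳 := 𝒳) (𝒴 := 𝒴) hfm hr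
    have hdm := fun i => measurable_mixYgivenZ (𝒳 := 𝒳) (𝒴 := 𝒴) hfm (hd i)
    refine Measurable.lintegral_prod_left' (f := fun p : ℝ × ℝ =>
      mixture (mixYgivenZ 𝒳 𝒴 f r) (fun i => mixYgivenZ 𝒳 𝒴 f (d i)) b ε p.1 p.2 ^ (1 - β) *
          (∑ i, (b i * mixYgivenZ 𝒳 𝒴 f (d i) p.1 p.2) ^ α) ^ (β / α)) ?_
    exact ((measurable_mixture hrm hdm).pow_const _).mul
      ((Finset.measurable_sum _ fun i _ => ((hdm i).const_mul _).pow_const _).pow_const _)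
  have hscale : (∑ i, (ε * b i) ^ α) ^ (β / α) = ε ^ β * (∑ i, b i ^ α) ^ (β / α) := by
    simp only [ENNReal.mul_rpow_of_nonneg ε _ hα0.le]
    rw [← Finset.mul_sum, ENNReal.mul_rpow_of_nonneg _ _ hβα.le, ← ENNReal.rpow_mul,
      mul_div_cancel₀ _ hα0.ne']
  have hM : ∀ M : ℕ, M ≠ 0 → ε ^ β * ∫⁻ z in A, pdfZ 𝒳 𝒴 f z * T z ≤
      L * (((M : ℝ≥0∞) * (M : ℝ≥0∞)⁻¹ ^ α + ∑ i, (ε * b i) ^ α) ^ (β / α) * p +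
        (((M + n : ℕ) : ℝ≥0∞) * ((M + n : ℕ) : ℝ≥0∞)⁻¹ ^ α) ^ (β / α)) := by
    intro M hM
    have hq := isCondPDF_testDensity (𝒵 := 𝒵) h𝒳 hfm hA hr hd hrA hdA hb hε
    have h1 := hL _ hq _ _ (isCondPMF_testKernel (b := b) (ε := ε) hA hr hd hM)
    have h2 := gainZ_test_le hα hβ h𝒳 h𝒵 hfm hZ hA hA𝒵 hr hd hrA hdA hrt hdt hb hε hM
    have h3 := le_gainYZ_test hα hβ h𝒳 hfm hA hA𝒵 hr hd hrA hdA hrt hdt hb hε hM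
    have hgt : gainZ α β 𝒳 𝒴 𝒵 f (testDensity 𝒳 𝒴 f A r d b ε) (testKernel A r d b ε M) ≠ ∞ := by
      have hM0 : ∀ k : ℕ, k ≠ 0 → (k : ℝ≥0∞)⁻¹ ^ α ≠ ∞ := fun k hk =>
        ENNReal.rpow_ne_top_of_nonneg hα0.le (ENNReal.inv_ne_top.2 (Nat.cast_ne_zero.2 hk))
      refine ne_top_of_le_ne_top ?_ h2
      refine ENNReal.add_ne_top.2 ⟨ENNReal.mul_ne_top (ENNReal.rpow_ne_top_of_nonneg hβα.le
        (ENNReal.add_ne_top.2 ⟨ENNReal.mul_ne_top (ENNReal.natCast_ne_top _) (hM0 M hM), ?_⟩)) hpt,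
        ENNReal.rpow_ne_top_of_nonneg hβα.le
          (ENNReal.mul_ne_top (ENNReal.natCast_ne_top _) (hM0 _ (by omega)))⟩
      exact ENNReal.sum_ne_top.2 fun i _ => ENNReal.rpow_ne_top_of_nonneg hα0.le
        (ENNReal.mul_ne_top hεt (ne_top_of_le_ne_top ENNReal.one_ne_top (hb1 i)))
    rw [ENNReal.div_le_iff_le_mul (Or.inr hLt) (Or.inl hgt)] at h1
    exact h3.trans (h1.trans (mul_le_mul' le_rfl h2))
  have hlim : Tendsto (fun M : ℕ =>
      L * (((M : ℝ≥0∞) * (M : ℝ≥0∞)⁻¹ ^ α + ∑ i, (ε * b i) ^ α) ^ (β / α) * p +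
        (((M + n : ℕ) : ℝ≥0∞) * ((M + n : ℕ) : ℝ≥0∞)⁻¹ ^ α) ^ (β / α))) atTop
      (𝓝 (L * ((0 + ∑ i, (ε * b i) ^ α) ^ (β / α) * p + 0 ^ (β / α)))) := by
    have ht := tendsto_natCast_mul_inv_rpow hα
    refine ENNReal.Tendsto.const_mul (Tendsto.add ?_ ?_) (Or.inr hLt)
    · exact ENNReal.Tendsto.mul_const ((ht.add_const _).ennrpow_const _) (Or.inr hpt)
    · exact ((tendsto_add_atTop_iff_nat n).2 ht).ennrpow_const _
  have hle : ε ^ β * ∫⁻ z in A, pdfZ 𝒳 𝒴 f z * T z ≤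
      ε ^ β * (L * (∑ i, b i ^ α) ^ (β / α) * p) := by
    have := ge_of_tendsto hlim ((eventually_ne_atTop 0).mono hM)
    rw [zero_add, ENNReal.zero_rpow_of_pos hβα, add_zero, hscale] at this
    refine this.trans_eq ?_
    ring
  have hle' := (ENNReal.mul_le_mul_iff_right hεβ0 hεβt).1 hle
  by_contra! hcon
  refine hle'.not_gt ?_
  rw [hp, ← lintegral_const_mul _ hpm]
  refine setLIntegral_strict_mono hA hA0 (hpm.mul hTm) ?_ (Eventually.of_forall fun z hz => ?_)
  · rw [lintegral_const_mul _ hpm]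
    exact ENNReal.mul_ne_top hct hpt
  · rw [mul_comm]
    exact ENNReal.mul_lt_mul_right (hA𝒵 hz).2.1.ne' (hA𝒵 hz).2.2.ne (hcon z hz)

end TestGains

/-! ### The lower bound at finitely many points -/

section LowerBound

open Filter Topology

variable {𝒳 𝒴 𝒵 : Set ℝ} {f : ℝ × ℝ × ℝ → ℝ} {α β : ℝ}

/-- No side condition is needed on the products, since `0 * ∞ = 0` is the smallest value. -/
theorem mul_le_liminf_mul {u v : ℕ → ℝ≥0∞} {a b : ℝ≥0∞} (hu : a ≤ liminf u atTop)
    (hv : b ≤ liminf v atTop) : a * b ≤ liminf (fun k => u k * v k) atTop :=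
  (mul_le_mul' hu hv).trans ENNReal.le_liminf_mul

theorem rpow_le_liminf_rpow {s : ℝ} (hs : 0 < s) {v : ℕ → ℝ≥0∞} {b : ℝ≥0∞}
    (hv : b ≤ liminf v atTop) : b ^ s ≤ liminf (fun k => v k ^ s) atTop := by
  have h := OrderIso.liminf_apply (f := atTop) (u := v) (ENNReal.orderIsoRpow s hs)
  simp only [ENNReal.orderIsoRpow_apply] at h
  rw [← h]
  exact ENNReal.rpow_le_rpow hv hs.le

/-- Fatou's lemma for uniformly bounded integrals. -/
theorem lintegral_le_of_le_liminf {A : Type*} [MeasurableSpace A] {μ : Measure A}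
    {F : A → ℝ≥0∞} {G : ℕ → A → ℝ≥0∞} (hG : ∀ k, Measurable (G k))
    (hF : ∀ᵐ y ∂μ, F y ≤ liminf (fun k => G k y) atTop) {c : ℝ≥0∞} (hc : ∀ k, ∫⁻ y, G k y ∂μ ≤ c) :
    ∫⁻ y, F y ∂μ ≤ c :=
  (lintegral_mono_ae hF).trans <| (lintegral_liminf_le hG).trans <|
    (liminf_le_liminf (Eventually.of_forall hc)).trans (by simp)

theorem continuousWithinAt_pdfYgivenXZ
    (hcond : ContinuousOn (fun p : ℝ × ℝ × ℝ => pdfYgivenXZ 𝒴 f p.2.1 p.1 p.2.2)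
      {p | p ∈ 𝒳 ×ˢ 𝒴 ×ˢ 𝒵 ∧ 0 < pdfXZ 𝒴 f p.1 p.2.2 ∧ pdfXZ 𝒴 f p.1 p.2.2 < ∞})
    {c : ℝ} (hc : c ∈ suppZ 𝒳 𝒴 𝒵 f) {a : ℝ} (ha : a ∈ suppX 𝒳 𝒴 f c) {y : ℝ} (hy : y ∈ 𝒴) :
    ContinuousWithinAt (fun p : ℝ × ℝ => pdfYgivenXZ 𝒴 f y p.1 p.2)
      {p | p.2 ∈ suppZ 𝒳 𝒴 𝒵 f ∧ p.1 ∈ suppX 𝒳 𝒴 f p.2} (a, c) := by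
  have ha' := (mem_suppX_iff hc).1 ha
  refine ContinuousWithinAt.comp (x := ((a, c) : ℝ × ℝ)) (f := fun p : ℝ × ℝ => (p.1, y, p.2))
    (g := fun p : ℝ × ℝ × ℝ => pdfYgivenXZ 𝒴 f p.2.1 p.1 p.2.2)
    (hcond (a, y, c) ⟨⟨ha'.1, hy, hc.1⟩, ha'.2⟩)
    (by fun_prop : Continuous fun p : ℝ × ℝ => (p.1, y, p.2)).continuousWithinAt fun p hp => ?_
  have hp' := (mem_suppX_iff hp.1).1 hp.2
  exact ⟨⟨hp'.1, hy, hp.1.1⟩, hp'.2⟩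

theorem tendsto_mixYgivenZ_localUniform (h𝒳 : MeasurableSet 𝒳) (hfm : Measurable f)
    (hcond : ContinuousOn (fun p : ℝ × ℝ × ℝ => pdfYgivenXZ 𝒴 f p.2.1 p.1 p.2.2)
      {p | p ∈ 𝒳 ×ˢ 𝒴 ×ˢ 𝒵 ∧ 0 < pdfXZ 𝒴 f p.1 p.2.2 ∧ pdfXZ 𝒴 f p.1 p.2.2 < ∞})
    {c : ℝ} (hc : c ∈ suppZ 𝒳 𝒴 𝒵 f) {a : ℝ} (ha : a ∈ suppX 𝒳 𝒴 f c) {y : ℝ} (hy : y ∈ 𝒴)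
    {δ : ℕ → ℝ} (hδ : Tendsto δ atTop (𝓝 0)) {z : ℕ → ℝ} (hz : ∀ k, z k ∈ Metric.ball c (δ k))
    (hzs : ∀ k, z k ∈ suppZ 𝒳 𝒴 𝒵 f)
    (hvol : ∀ k, volume (suppX 𝒳 𝒴 f (z k) ∩ Metric.ball a (δ k)) ≠ 0) :
    Tendsto (fun k => mixYgivenZ 𝒳 𝒴 f (localUniform 𝒳 𝒴 f a (δ k)) y (z k)) atTop
      (𝓝 (pdfYgivenXZ 𝒴 f y a c)) := by
  have hpdf := fun k => isPDFOn_localUniform hfm h𝒳 (hvol k)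
  have := tendsto_lintegral_of_concentrating (continuousWithinAt_pdfYgivenXZ hcond hc ha hy) hδ hz
    hpdf fun k x hx => ⟨⟨hzs k, hx.1⟩, hx.2⟩
  refine this.congr fun k => ?_
  exact ((hpdf k).setLIntegral_eq (inter_subset_left.trans (suppX_subset _)) _).symm

/-- The inequality for inputs that are concentrated at finitely many points: letting the uniform
densities around the points `a i` and `a₀`, the parameter `z` and the weight `ε` converge, the
component around `a₀` determines the output density, the components around `a i` the gain. -/
theorem lintegral_finite_points_le (hα : 1 < α) (hβ : 1 ≤ β) (h𝒳 : MeasurableSet 𝒳)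
    (h𝒴 : MeasurableSet 𝒴) (h𝒵 : MeasurableSet 𝒵) (h𝒳' : 𝒳 ⊆ closure (interior 𝒳))
    (h𝒵' : 𝒵 ⊆ closure (interior 𝒵)) (hfm : Measurable f) (hf : ContinuousOn f (𝒳 ×ˢ 𝒴 ×ˢ 𝒵))
    (hcond : ContinuousOn (fun p : ℝ × ℝ × ℝ => pdfYgivenXZ 𝒴 f p.2.1 p.1 p.2.2)
      {p | p ∈ 𝒳 ×ˢ 𝒴 ×ˢ 𝒵 ∧ 0 < pdfXZ 𝒴 f p.1 p.2.2 ∧ pdfXZ 𝒴 f p.1 p.2.2 < ∞})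
    (hZ : ∫⁻ z in 𝒵, pdfZ 𝒳 𝒴 f z = 1) {L : ℝ≥0∞} (hLt : L ≠ ∞)
    (hL : ∀ q, IsCondPDF 𝒳 𝒴 𝒵 f q → ∀ (m : ℕ) (w : Fin m → ℝ × ℝ → ℝ≥0∞), IsCondPMF w →
      gainYZ α β 𝒳 𝒴 𝒵 f q w / gainZ α β 𝒳 𝒴 𝒵 f q w ≤ L)
    {c : ℝ} (hc : c ∈ suppZ 𝒳 𝒴 𝒵 f) {a₀ : ℝ} (ha₀ : a₀ ∈ suppX 𝒳 𝒴 f c) {n : ℕ}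
    {a : Fin n → ℝ} (ha : ∀ i, a i ∈ suppX 𝒳 𝒴 f c) {b : Fin n → ℝ≥0∞} (hb : ∑ i, b i = 1) :
    ∫⁻ y in 𝒴, pdfYgivenXZ 𝒴 f y a₀ c ^ (1 - β) *
        (∑ i, (b i * pdfYgivenXZ 𝒴 f y (a i) c) ^ α) ^ (β / α) ≤
      L * (∑ i, b i ^ α) ^ (β / α) := by
  have hα0 : 0 < α := by linarith
  have hβα : 0 < β / α := by apply div_pos <;> linarith
  set δ : ℕ → ℝ := fun k => 1 / ((k : ℝ) + 1) with hδ
  have hδ0 : ∀ k, 0 < δ k := fun k => Nat.one_div_pos_of_nat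
  have hδlim : Tendsto δ atTop (𝓝 0) := tendsto_one_div_add_atTop_nhds_zero_nat
  set ε : ℕ → ℝ≥0∞ := fun k => ((k + 1 : ℕ) : ℝ≥0∞)⁻¹ with hε
  have hε0 : ∀ k, ε k ≠ 0 := fun k => ENNReal.inv_ne_zero.2 (ENNReal.natCast_ne_top _)
  have hε1 : ∀ k, ε k ≤ 1 := fun k => ENNReal.inv_le_one.2 (by exact_mod_cast Nat.le_add_left 1 k)
  have hεlim : Tendsto ε atTop (𝓝 0) :=
    (tendsto_add_atTop_iff_nat 1).2 ENNReal.tendsto_inv_nat_nhds_zero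
  have hexA := fun k => exists_measurableSet_suppX_inter_ball h𝒳 h𝒴 h𝒵 h𝒳' h𝒵' hfm hf
    (hZ ▸ ENNReal.one_ne_top) hc (a := fun o : Option (Fin n) => o.elim a₀ a)
    (by rintro (_ | i); exacts [ha₀, ha i]) (hδ0 k)
  choose A hA hAs hAball hA0 hAvol using hexA
  have hvol₀ : ∀ k, ∀ z ∈ A k, volume (suppX 𝒳 𝒴 f z ∩ Metric.ball a₀ (δ k)) ≠ 0 :=
    fun k z hz => hAvol k z hz none
  have hvol : ∀ k, ∀ z ∈ A k, ∀ i, volume (suppX 𝒳 𝒴 f z ∩ Metric.ball (a i) (δ k)) ≠ 0 :=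
    fun k z hz i => hAvol k z hz (some i)
  have hrm := fun k => measurable_localUniform (𝒴 := 𝒴) hfm h𝒳 a₀ (δ k)
  have hdm := fun k i => measurable_localUniform (𝒴 := 𝒴) hfm h𝒳 (a i) (δ k)
  have hex := fun k => exists_mem_lintegral_le (ε := ε k) (b := b)
    (r := localUniform 𝒳 𝒴 f a₀ (δ k)) (d := fun i => localUniform 𝒳 𝒴 f (a i) (δ k))
    hα hβ h𝒳 h𝒵 hfm hZ hLt hL (hA k) (hAs k) (hA0 k) (hrm k) (hdm k)
    (fun z hz => (isPDFOn_localUniform hfm h𝒳 (hvol₀ k z hz)).mono inter_subset_left)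
    (fun z hz i => (isPDFOn_localUniform hfm h𝒳 (hvol k z hz i)).mono inter_subset_left)
    (fun z hz x => localUniform_ne_top (hvol₀ k z hz))
    (fun z hz i x => localUniform_ne_top (hvol k z hz i)) hb (hε0 k) (hε1 k)
  choose z hzA hle using hex
  refine lintegral_le_of_le_liminf (fun k => ?_) ?_ hle
  · have hm₀ := (measurable_mixYgivenZ (𝒳 := 𝒳) (𝒴 := 𝒴) hfm (hrm k))
    have hm := fun i => (measurable_mixYgivenZ (𝒳 := 𝒳) (𝒴 := 𝒴) hfm (hdm k i))
    refine Measurable.mul (((measurable_mixture hm₀ hm).comp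
      (by fun_prop : Measurable fun y : ℝ => (y, z k))).pow_const _) ?_
    refine (Finset.measurable_sum _ fun i _ => ?_).pow_const _
    exact (((hm i).comp (by fun_prop : Measurable fun y : ℝ => (y, z k))).const_mul _).pow_const _
  · filter_upwards [ae_restrict_mem h𝒴] with y hy
    have ht₀ := tendsto_mixYgivenZ_localUniform h𝒳 hfm hcond hc ha₀ hy hδlim
      (fun k => hAball k (hzA k)) (fun k => hAs k (hzA k)) (fun k => hvol₀ k _ (hzA k))
    have ht := fun i => tendsto_mixYgivenZ_localUniform h𝒳 hfm hcond hc (ha i) hy hδlim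
      (fun k => hAball k (hzA k)) (fun k => hAs k (hzA k)) (fun k => hvol k _ (hzA k) i)
    have hKt : ∀ x ∈ suppX 𝒳 𝒴 f c, pdfYgivenXZ 𝒴 f y x c ≠ ∞ := fun x hx =>
      pdfYgivenXZ_ne_top ((mem_suppX_iff hc).1 hx).2.1
    have hbt : ∀ i, b i ≠ ∞ := fun i => ne_top_of_le_ne_top ENNReal.one_ne_top <| hb ▸
      Finset.single_le_sum (f := b) (fun _ _ => zero_le) (Finset.mem_univ i)
    have hmix : Tendsto (fun k => mixture (mixYgivenZ 𝒳 𝒴 f (localUniform 𝒳 𝒴 f a₀ (δ k)))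
        (fun i => mixYgivenZ 𝒳 𝒴 f (localUniform 𝒳 𝒴 f (a i) (δ k))) b (ε k) y (z k)) atTop
        (𝓝 ((1 - 0) * pdfYgivenXZ 𝒴 f y a₀ c +
          ∑ i, 0 * b i * pdfYgivenXZ 𝒴 f y (a i) c)) := by
      refine Tendsto.add ?_ (tendsto_finsetSum _ fun i _ => ?_)
      · refine ENNReal.Tendsto.mul (ENNReal.Tendsto.sub tendsto_const_nhds hεlim (by simp))
          (Or.inr (hKt _ ha₀)) ht₀ (Or.inr (by simp))
      · refine ENNReal.Tendsto.mul (ENNReal.Tendsto.mul_const hεlim (Or.inr (hbt i)))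
          (Or.inr (hKt _ (ha i))) (ht i) (Or.inr (by simp))
    simp only [zero_mul, Finset.sum_const_zero, add_zero, tsub_zero, one_mul] at hmix
    refine mul_le_liminf_mul (hmix.ennrpow_const _).liminf_eq.ge
      (Tendsto.liminf_eq (Tendsto.ennrpow_const _ (tendsto_finsetSum _ fun i _ =>
        Tendsto.ennrpow_const _ ?_))).ge
    exact ENNReal.Tendsto.const_mul (ht i) (Or.inr (hbt i))

end LowerBound

/-! ### The lower bound for densities, and the formula -/

section LowerBoundDensity

open Filter Topology

variable {𝒳 𝒴 𝒵 : Set ℝ} {f : ℝ × ℝ × ℝ → ℝ} {α β : ℝ}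

/-- Reparametrising the weights by `b i ∝ p i ^ (1 / α)` turns an inequality for `α`-th powers of
weighted values into one for weighted averages of `α`-th powers. -/
theorem lintegral_weighted_le {A : Type*} [MeasurableSpace A] {μ : Measure A} (hα : 1 < α)
    (hβ : 1 ≤ β) {k₀ : A → ℝ≥0∞} {n : ℕ} {k : Fin n → A → ℝ≥0∞} {L : ℝ≥0∞}
    (h : ∀ b : Fin n → ℝ≥0∞, ∑ i, b i = 1 →
      ∫⁻ y, k₀ y * (∑ i, (b i * k i y) ^ α) ^ (β / α) ∂μ ≤ L * (∑ i, b i ^ α) ^ (β / α))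
    {p : Fin n → ℝ≥0∞} (hp : ∑ i, p i = 1) :
    ∫⁻ y, k₀ y * (∑ i, p i * k i y ^ α) ^ (β / α) ∂μ ≤ L := by
  have hα0 : 0 < α := by linarith
  have hβα : 0 < β / α := by apply div_pos <;> linarith
  set s : ℝ≥0∞ := ∑ i, p i ^ (1 / α) with hs
  have hp1 : ∀ i, p i ≤ 1 := fun i => hp ▸
    Finset.single_le_sum (f := p) (fun _ _ => zero_le) (Finset.mem_univ i)
  have hst : s ≠ ∞ := ENNReal.sum_ne_top.2 fun i _ =>
    ENNReal.rpow_ne_top_of_nonneg (by positivity) (ne_top_of_le_ne_top ENNReal.one_ne_top (hp1 i))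
  have hs0 : s ≠ 0 := by
    intro h0
    have : ∀ i, p i = 0 := fun i => by
      have := (Finset.sum_eq_zero_iff.1 h0) i (Finset.mem_univ i)
      simpa [ENNReal.rpow_eq_zero_iff, hα0, hα0.not_gt] using this
    simp [this] at hp
  have hb : ∑ i, p i ^ (1 / α) * s⁻¹ = 1 := by
    rw [← Finset.sum_mul, ENNReal.mul_inv_cancel hs0 hst]
  have hpow : ∀ i, (p i ^ (1 / α) * s⁻¹) ^ α = (s⁻¹) ^ α * p i := fun i => by
    rw [ENNReal.mul_rpow_of_nonneg _ _ hα0.le, ← ENNReal.rpow_mul, one_div_mul_cancel hα0.ne',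
      ENNReal.rpow_one, mul_comm]
  have hscale : ((s⁻¹) ^ α) ^ (β / α) = (s⁻¹) ^ β := by
    rw [← ENNReal.rpow_mul, mul_div_cancel₀ _ hα0.ne']
  have hs0' : (s⁻¹) ^ β ≠ 0 := (ENNReal.rpow_pos (ENNReal.inv_pos.2 hst)
    (ENNReal.inv_ne_top.2 hs0)).ne'
  have hst' : (s⁻¹) ^ β ≠ ∞ :=
    ENNReal.rpow_ne_top_of_nonneg (by linarith) (ENNReal.inv_ne_top.2 hs0)
  have H := h _ hb
  have e1 : ∑ i, (p i ^ (1 / α) * s⁻¹) ^ α = (s⁻¹) ^ α := by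
    simp only [hpow]
    rw [← Finset.mul_sum, hp, mul_one]
  have e2 : ∀ y, k₀ y * (∑ i, (p i ^ (1 / α) * s⁻¹ * k i y) ^ α) ^ (β / α) =
      (s⁻¹) ^ β * (k₀ y * (∑ i, p i * k i y ^ α) ^ (β / α)) := fun y => by
    have : ∀ i, (p i ^ (1 / α) * s⁻¹ * k i y) ^ α = (s⁻¹) ^ α * (p i * k i y ^ α) := fun i => by
      rw [ENNReal.mul_rpow_of_nonneg _ _ hα0.le, hpow, mul_assoc]
    simp only [this]
    rw [← Finset.mul_sum, ENNReal.mul_rpow_of_nonneg _ _ hβα.le, hscale, mul_left_comm]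
  simp only [e1, e2, hscale] at H
  rw [lintegral_const_mul' _ _ hst', mul_comm L] at H
  exact (ENNReal.mul_le_mul_iff_right hs0' hst').1 H

theorem IsPDFOn.ae_mem {S : Set ℝ} {g : ℝ → ℝ≥0∞} (hg : IsPDFOn S g) :
    ∀ᵐ x ∂volume.withDensity g, x ∈ S := by
  rw [ae_withDensity_iff hg.measurable]
  refine Eventually.of_forall fun x hx => ?_
  by_contra h
  exact hx (hg.zero_off x h)

/-- A bound `L` of all leakage ratios bounds the functional on the right-hand side of the formula:
a density `g` is the limit of its images under simple functions `φ k` with values in the support. -/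
theorem lintegral_density_le (hα : 1 < α) (hβ : 1 ≤ β) (h𝒳 : MeasurableSet 𝒳)
    (h𝒴 : MeasurableSet 𝒴) (h𝒵 : MeasurableSet 𝒵) (h𝒳' : 𝒳 ⊆ closure (interior 𝒳))
    (h𝒵' : 𝒵 ⊆ closure (interior 𝒵)) (hfm : Measurable f) (hf : ContinuousOn f (𝒳 ×ˢ 𝒴 ×ˢ 𝒵))
    (hcond : ContinuousOn (fun p : ℝ × ℝ × ℝ => pdfYgivenXZ 𝒴 f p.2.1 p.1 p.2.2)
      {p | p ∈ 𝒳 ×ˢ 𝒴 ×ˢ 𝒵 ∧ 0 < pdfXZ 𝒴 f p.1 p.2.2 ∧ pdfXZ 𝒴 f p.1 p.2.2 < ∞})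
    (hZ : ∫⁻ z in 𝒵, pdfZ 𝒳 𝒴 f z = 1) {L : ℝ≥0∞}
    (hL : ∀ q, IsCondPDF 𝒳 𝒴 𝒵 f q → ∀ (m : ℕ) (w : Fin m → ℝ × ℝ → ℝ≥0∞), IsCondPMF w →
      gainYZ α β 𝒳 𝒴 𝒵 f q w / gainZ α β 𝒳 𝒴 𝒵 f q w ≤ L)
    {c : ℝ} (hc : c ∈ suppZ 𝒳 𝒴 𝒵 f) {a₀ : ℝ} (ha₀ : a₀ ∈ suppX 𝒳 𝒴 f c)
    {g : ℝ → ℝ≥0∞} (hg : IsPDFOn (suppX 𝒳 𝒴 f c) g) :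
    ∫⁻ y in 𝒴, pdfYgivenXZ 𝒴 f y a₀ c ^ (1 - β) *
        (∫⁻ x in 𝒳, pdfYgivenXZ 𝒴 f y x c ^ α * g x) ^ (β / α) ≤ L := by
  rcases eq_or_ne L ∞ with rfl | hLt
  · exact le_top
  have hα0 : 0 < α := by linarith
  have hβα : 0 < β / α := by apply div_pos <;> linarith
  set ν : Measure ℝ := volume.withDensity g with hν
  have hν1 : ν univ = 1 := by
    rw [hν, withDensity_apply _ MeasurableSet.univ, Measure.restrict_univ, hg.lintegral_eq_one]
  have hK2 : Measurable fun p : ℝ × ℝ => pdfYgivenXZ 𝒴 f p.1 p.2 c :=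
    (measurable_pdfYgivenXZ hfm).comp (by fun_prop : Measurable fun p : ℝ × ℝ => (p.1, p.2, c))
  have hKx : ∀ y, Measurable fun x => pdfYgivenXZ 𝒴 f y x c := fun y =>
    hK2.comp (by fun_prop : Measurable fun x : ℝ => (y, x))
  have hKy : ∀ x, Measurable fun y => pdfYgivenXZ 𝒴 f y x c := fun x =>
    hK2.comp (by fun_prop : Measurable fun y : ℝ => (y, x))
  have hint : ∀ y, ∫⁻ x in 𝒳, pdfYgivenXZ 𝒴 f y x c ^ α * g x =
      ∫⁻ x, pdfYgivenXZ 𝒴 f y x c ^ α ∂ν := fun y => by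
    simp only [mul_comm _ (g _)]
    rw [hg.setLIntegral_eq (suppX_subset c), hν,
      lintegral_withDensity_eq_lintegral_mul _ hg.measurable ((hKx y).pow_const α)]
    rfl
  set φ : ℕ → SimpleFunc ℝ ℝ :=
    SimpleFunc.approxOn id measurable_id (suppX 𝒳 𝒴 f c) a₀ ha₀ with hφ
  have hφmem : ∀ k x, φ k x ∈ suppX 𝒳 𝒴 f c := fun k x =>
    SimpleFunc.approxOn_mem measurable_id ha₀ k x
  have hφlim : ∀ x ∈ suppX 𝒳 𝒴 f c, Tendsto (fun k => φ k x) atTop (𝓝 x) := fun x hx =>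
    SimpleFunc.tendsto_approxOn measurable_id ha₀ (subset_closure hx)
  have hsimple : ∀ k y, ∫⁻ x, pdfYgivenXZ 𝒴 f y (φ k x) c ^ α ∂ν =
      ∑ t ∈ (φ k).range, pdfYgivenXZ 𝒴 f y t c ^ α * ν (φ k ⁻¹' {t}) := fun k y => by
    rw [← SimpleFunc.map_lintegral, ← SimpleFunc.lintegral_eq_lintegral]
    rfl
  have hstep : ∀ k, ∫⁻ y in 𝒴, pdfYgivenXZ 𝒴 f y a₀ c ^ (1 - β) *
      (∫⁻ x, pdfYgivenXZ 𝒴 f y (φ k x) c ^ α ∂ν) ^ (β / α) ≤ L := by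
    intro k
    set e := (φ k).range.equivFin
    have hsum : ∀ h : ℝ → ℝ≥0∞, ∑ t ∈ (φ k).range, h t = ∑ i, h (e.symm i) := fun h => by
      rw [← Finset.sum_coe_sort, ← Equiv.sum_comp e.symm]
    simp only [hsimple, hsum, mul_comm (_ ^ α)]
    refine lintegral_weighted_le hα hβ (fun b hb => ?_) ?_
    · refine lintegral_finite_points_le hα hβ h𝒳 h𝒴 h𝒵 h𝒳' h𝒵' hfm hf hcond hZ hLt hL hc ha₀
        (fun i => ?_) hb
      obtain ⟨x, hx⟩ := SimpleFunc.mem_range.1 (e.symm i).2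
      exact hx ▸ hφmem k x
    · rw [← hsum fun t => ν (φ k ⁻¹' {t}), ← hν1]
      exact SimpleFunc.sum_range_measure_preimage_singleton _ _
  simp only [hint]
  refine lintegral_le_of_le_liminf (fun k => ?_) ?_ hstep
  · simp only [hsimple]
    exact ((hKy a₀).pow_const _).mul ((Finset.measurable_sum _ fun t _ =>
      ((hKy t).pow_const _).mul_const _).pow_const _)
  · filter_upwards [ae_restrict_mem h𝒴] with y hy
    refine mul_le_liminf_mul (by simp) (rpow_le_liminf_rpow hβα ?_)
    refine le_trans (lintegral_mono_ae ?_) (lintegral_liminf_le fun k =>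
      ((hKx y).comp (φ k).measurable).pow_const α)
    filter_upwards [hg.ae_mem] with x hx
    refine (Tendsto.liminf_eq (Tendsto.ennrpow_const _ ?_)).ge
    refine (continuousWithinAt_pdfYgivenXZ hcond hc hx hy).tendsto.comp
      (f := fun k => ((φ k x, c) : ℝ × ℝ)) (tendsto_nhdsWithin_iff.2 ⟨?_, ?_⟩)
    · exact (hφlim x hx).prodMk_nhds tendsto_const_nhds
    · exact Eventually.of_forall fun k => ⟨hc, hφmem k x⟩

end LowerBoundDensity

section Conclusion

variable {𝒳 𝒴 𝒵 : Set ℝ} {f g : ℝ × ℝ × ℝ → ℝ} {α β : ℝ}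

theorem leakage_congr (h𝒳 : MeasurableSet 𝒳) (h𝒴 : MeasurableSet 𝒴) (h𝒵 : MeasurableSet 𝒵)
    (h : EqOn f g (𝒳 ×ˢ 𝒴 ×ˢ 𝒵)) (α β : ℝ) :
    leakage α β 𝒳 𝒴 𝒵 f = leakage α β 𝒳 𝒴 𝒵 g := by
  have hiff : ∀ q, IsCondPDF 𝒳 𝒴 𝒵 f q ↔ IsCondPDF 𝒳 𝒴 𝒵 g q := fun q =>
    ⟨isCondPDF_congr h𝒳 h𝒴 h, isCondPDF_congr h𝒳 h𝒴 h.symm⟩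
  simp only [leakage, hiff, gainYZ_congr h𝒳 h𝒴 h𝒵 h, gainZ_congr h𝒳 h𝒴 h𝒵 h]

theorem HasJointPDF.congr {Ω : Type*} [MeasurableSpace Ω] {P : Measure Ω} {X Y Z : Ω → ℝ}
    (h𝒳 : MeasurableSet 𝒳) (h𝒴 : MeasurableSet 𝒴) (h𝒵 : MeasurableSet 𝒵)
    (h : EqOn f g (𝒳 ×ˢ 𝒴 ×ˢ 𝒵)) (hf : HasJointPDF P X Y Z 𝒳 𝒴 𝒵 f) :
    HasJointPDF P X Y Z 𝒳 𝒴 𝒵 g := by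
  refine ⟨hf.measurable_X, hf.measurable_Y, hf.measurable_Z, fun p hp => h hp ▸ hf.nonneg p hp, ?_⟩
  rw [hf.law]
  refine withDensity_congr_ae ?_
  filter_upwards [ae_restrict_mem (h𝒳.prod (h𝒴.prod h𝒵))] with p hp
  rw [h hp]

/-- Passing from suprema of logarithms in `EReal` to bounds in `ℝ≥0∞`. -/
theorem coe_mul_log_le_iff {r : ℝ} (hr : 0 < r) (x : ℝ≥0∞) (R : EReal) :
    (r : EReal) * ENNReal.log x ≤ R ↔ x ≤ EReal.exp (R / r) := by
  rw [mul_comm, ← EReal.le_div_iff_mul_le (by exact_mod_cast hr) (EReal.coe_ne_top r)]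
  conv_rhs => rw [← ENNReal.log_le_log_iff, EReal.log_exp]

/-- The single-letter formula for a joint density that is measurable on the whole space. -/
theorem leakage_eq_of_measurable (hα : 1 < α) (hβ : 1 ≤ β) (h𝒳 : MeasurableSet 𝒳)
    (h𝒴 : MeasurableSet 𝒴) (h𝒵 : MeasurableSet 𝒵) (h𝒳' : 𝒳 ⊆ closure (interior 𝒳))
    (h𝒵' : 𝒵 ⊆ closure (interior 𝒵)) (hfm : Measurable f) (hf : ContinuousOn f (𝒳 ×ˢ 𝒴 ×ˢ 𝒵))
    (hcond : ContinuousOn (fun p : ℝ × ℝ × ℝ => pdfYgivenXZ 𝒴 f p.2.1 p.1 p.2.2)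
      {p | p ∈ 𝒳 ×ˢ 𝒴 ×ˢ 𝒵 ∧ 0 < pdfXZ 𝒴 f p.1 p.2.2 ∧ pdfXZ 𝒴 f p.1 p.2.2 < ∞})
    (hZ : ∫⁻ z in 𝒵, pdfZ 𝒳 𝒴 f z = 1) :
    leakage α β 𝒳 𝒴 𝒵 f =
      ⨆ z ∈ suppZ 𝒳 𝒴 𝒵 f, ⨆ x' ∈ suppX 𝒳 𝒴 f z,
        ⨆ (g : ℝ → ℝ≥0∞) (_ : IsPDFOn (suppX 𝒳 𝒴 f z) g),
          ((α / ((α - 1) * β) : ℝ) : EReal) *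
            ENNReal.log (∫⁻ y in 𝒴, pdfYgivenXZ 𝒴 f y x' z ^ (1 - β) *
              (∫⁻ x in 𝒳, pdfYgivenXZ 𝒴 f y x z ^ α * g x) ^ (β / α)) := by
  have hr : 0 < α / ((α - 1) * β) := by
    have : 0 < α - 1 := by linarith
    positivity
  apply le_antisymm
  · refine iSup₂_le fun q hq => iSup_le fun n => iSup₂_le fun w hw => ?_
    rw [coe_mul_log_le_iff hr]
    refine gainYZ_div_gainZ_le hfm h𝒵 hα hβ (hZ ▸ ENNReal.one_ne_top) hq hw
      fun z hz x' hx' g hg => ?_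
    rw [← coe_mul_log_le_iff hr]
    exact le_iSup₂_of_le z hz (le_iSup₂_of_le x' hx' (le_iSup₂_of_le g hg le_rfl))
  · refine iSup₂_le fun z hz => iSup₂_le fun x' hx' => iSup₂_le fun g hg => ?_
    rw [coe_mul_log_le_iff hr]
    refine lintegral_density_le hα hβ h𝒳 h𝒴 h𝒵 h𝒳' h𝒵' hfm hf hcond hZ
      (fun q hq n w hw => ?_) hz hx' hg
    rw [← coe_mul_log_le_iff hr]
    exact le_iSup₂_of_le q hq (le_iSup_of_le n (le_iSup₂_of_le w hw le_rfl))

end Conclusion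

end CondLeakage

theorem theorem7 {Ω : Type*} [MeasurableSpace Ω] (P : Measure Ω) [IsProbabilityMeasure P]
    (X Y Z : Ω → ℝ) (𝒳 𝒴 𝒵 : Set ℝ)
    (h𝒳 : MeasurableSet 𝒳) (h𝒴 : MeasurableSet 𝒴) (h𝒵 : MeasurableSet 𝒵)
    (h𝒳' : 𝒳 ⊆ closure (interior 𝒳)) (h𝒵' : 𝒵 ⊆ closure (interior 𝒵))
    (f : ℝ × ℝ × ℝ → ℝ)
    (hpdf : CondLeakage.HasJointPDF P X Y Z 𝒳 𝒴 𝒵 f)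
    (hf : ContinuousOn f (𝒳 ×ˢ 𝒴 ×ˢ 𝒵))
    (hcond : ContinuousOn
      (fun p : ℝ × ℝ × ℝ => CondLeakage.pdfYgivenXZ 𝒴 f p.2.1 p.1 p.2.2)
      {p | p ∈ 𝒳 ×ˢ 𝒴 ×ˢ 𝒵 ∧ 0 < CondLeakage.pdfXZ 𝒴 f p.1 p.2.2 ∧
        CondLeakage.pdfXZ 𝒴 f p.1 p.2.2 < ∞})
    (α β : ℝ) (hα : 1 < α) (hβ : 1 ≤ β) :
    CondLeakage.leakage α β 𝒳 𝒴 𝒵 f =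
      ⨆ z ∈ CondLeakage.suppZ 𝒳 𝒴 𝒵 f, ⨆ x' ∈ CondLeakage.suppX 𝒳 𝒴 f z,
        ⨆ (g : ℝ → ℝ≥0∞) (_ : CondLeakage.IsPDFOn (CondLeakage.suppX 𝒳 𝒴 f z) g),
          ((α / ((α - 1) * β) : ℝ) : EReal) *
            ENNReal.log (∫⁻ y in 𝒴, CondLeakage.pdfYgivenXZ 𝒴 f y x' z ^ (1 - β) *
              (∫⁻ x in 𝒳, CondLeakage.pdfYgivenXZ 𝒴 f y x z ^ α * g x) ^ (β / α)) := by
  classical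
  have hmeas : MeasurableSet (𝒳 ×ˢ 𝒴 ×ˢ 𝒵) := h𝒳.prod (h𝒴.prod h𝒵)
  -- off the alphabets `f` is arbitrary, possibly non-measurable, so it is replaced by zero there
  set F : ℝ × ℝ × ℝ → ℝ := (𝒳 ×ˢ 𝒴 ×ˢ 𝒵).piecewise f 0 with hF
  have hFm : Measurable F := hf.measurable_piecewise continuousOn_const hmeas
  have h : EqOn f F (𝒳 ×ˢ 𝒴 ×ˢ 𝒵) := fun p hp => (piecewise_eq_of_mem _ _ _ hp).symm
  have hset : {p : ℝ × ℝ × ℝ | p ∈ 𝒳 ×ˢ 𝒴 ×ˢ 𝒵 ∧ 0 < CondLeakage.pdfXZ 𝒴 f p.1 p.2.2 ∧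
      CondLeakage.pdfXZ 𝒴 f p.1 p.2.2 < ∞} =
      {p | p ∈ 𝒳 ×ˢ 𝒴 ×ˢ 𝒵 ∧ 0 < CondLeakage.pdfXZ 𝒴 F p.1 p.2.2 ∧
      CondLeakage.pdfXZ 𝒴 F p.1 p.2.2 < ∞} := by
    ext p
    exact and_congr_right fun hp => by rw [CondLeakage.pdfXZ_congr h𝒴 h hp.1 hp.2.2]
  have hcondF := hcond.congr (g := fun p : ℝ × ℝ × ℝ =>
    CondLeakage.pdfYgivenXZ 𝒴 F p.2.1 p.1 p.2.2) fun p hp =>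
      (CondLeakage.pdfYgivenXZ_congr h𝒴 h hp.1.1 hp.1.2.1 hp.1.2.2).symm
  rw [hset] at hcondF
  rw [CondLeakage.leakage_congr h𝒳 h𝒴 h𝒵 h,
    CondLeakage.leakage_eq_of_measurable hα hβ h𝒳 h𝒴 h𝒵 h𝒳' h𝒵' hFm (hf.congr h.symm) hcondF
    (CondLeakage.lintegral_pdfZ hFm (hpdf.congr h𝒳 h𝒴 h𝒵 h)),
    CondLeakage.suppZ_congr h𝒳 h𝒴 h]
  refine iSup_congr fun z => iSup_congr fun hz => ?_
  rw [CondLeakage.suppX_congr h𝒳 h𝒴 h hz.1]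
  refine iSup_congr fun x' => iSup_congr fun hx' => iSup_congr fun g => iSup_congr fun _ => ?_
  congr 2
  refine setLIntegral_congr_fun h𝒴 fun y hy => ?_
  simp only [CondLeakage.pdfYgivenXZ_congr h𝒴 h (CondLeakage.suppX_subset z hx') hy hz.1]
  congr 2
  refine setLIntegral_congr_fun h𝒳 fun x hx => ?_
  simp only [CondLeakage.pdfYgivenXZ_congr h𝒴 h hx hy hz.1]
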